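/- All graphs are finite and simple. Local complementation at a vertex $v$ of a graph replaces the subgraph induced on the neighbourhood $N(v)$ by its complement; a graph contains $H$ as a vertex-minor if a graph isomorphic to $H$ can be obtained from it by a sequence of vertex deletions and local complementations. For vertex sets $A,B$ of a graph $G$: $A$ and $B$ are anti-complete if there is no edge between $A$ and $B$; $A$ covers $B$ if every vertex of $B$ has a neighbour in $A$; $N(A)$ is the set of vertices outside $A$ that have a neighbour in $A$; and $[n]=\{1,\dots,n\}$. Distances between vertices of different components are infinite. A collection $\mathcal L=(L^0,L^1,L^2,L^3)$ of vertex sets is a long cover of a set $C\subseteq V(G)$ if $L^0,L^1,L^2,L^3,C$ are pairwise disjoint, $G[L^0]$ is connected (and non-empty), $L^a$ covers $L^{a+1}$ for $a\in\{0,1,2\}$, $L^3$ covers $C$, $C$ is anti-complete to $L^a$ for $a\in\{0,1,2\}$, and $L^a$ is anti-complete to $L^b$ whenever $|a-b|>1$. A long $q$-cover of $C$ is a family $(\mathcal L_i:i\in[q])$ of long covers $\mathcal L_i=(L^0_i,L^1_i,L^2_i,L^3_i)$ of $C$ such that the sets $L_i^0\cup L_i^1\cup L_i^2\cup L_i^3$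 $(i\in[q])$ are pairwise disjoint and, for all $i<j$ in $[q]$, the set $L^0_j\cup L^1_j\cup L^2_j$ is anti-complete to $L^0_i\cup L^1_i\cup L^2_i\cup L^3_i$. An induced path $P$ (with at least one vertex) of a graph dangles spaciously from a set $X$ of vertices if $N(V(P))=X$ and any two distinct vertices of $X$ are at distance at least $6$. Induced paths $P_1,\dots,P_h$ of $G$ that are disjoint from all the sets $L_i^a$ dangle spaciously from the long $q$-cover $(\mathcal L_i:i\in[q])$ if they are pairwise disjoint and anti-complete to each other and there are distinct vertices $m_{i,j}$ $(i\in[q],\,j\in[h])$ of $G$, pairwise at distance at least $6$ in $G$, such that $m_{i,j}\in L_i^3$ for all $i,j$, and such that for each $j\in[h]$ the path $P_j$ dangles spaciously from $\{m_{1,j},\dots,m_{q,j}\}$ in the subgraph of $G$ induced by all the sets $L_i^a$ and the vertices of $P_1,\dots,P_h$. Lemma. Let $H$ be a graph. Then there exist positive integers $q'$ and $h'$ such that every graph $G$ containing a long $q'$-cover $(\mathcal L_i : i\in[q'])$ (of some set $C\subseteq V(G)$) with $h'$ paths $P_1,\dots,P_{h'}$ dangling spaciously from it contains $H$ as a vertex-minor.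 -/

import Mathlib

namespace VMinor

universe u v w

/-- `G * v`: the subgraph induced on the neighbourhood of `v` is replaced by its complement. -/
def localComplement {V : Type u} (G : SimpleGraph V) (v : V) : SimpleGraph V where
  Adj x y := x ≠ y ∧ Xor (G.Adj x y) (G.Adj v x ∧ G.Adj v y)
  symm := ⟨fun x y h => ⟨h.1.symm, by
    have h2 := h.2
    rw [G.adj_comm x y, and_comm (a := G.Adj v x)] at h2
    exact h2⟩⟩
  loopless := ⟨fun _ h => h.1 rfl⟩

/-- `HasVertexMinor H G`: a graph isomorphic to `H` can be obtained from `G` by a finite sequence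
of vertex deletions and local complementations. -/
inductive HasVertexMinor {W : Type w} (H : SimpleGraph W) :
    {V : Type v} → SimpleGraph V → Prop
  | iso {V : Type v} {G : SimpleGraph V} (e : G ≃g H) : HasVertexMinor H G
  | localComplement {V : Type v} {G : SimpleGraph V} (x : V)
      (h : HasVertexMinor H (VMinor.localComplement G x)) : HasVertexMinor H G
  | deleteVertex {V : Type v} {G : SimpleGraph V} (x : V)
      (h : HasVertexMinor H (G.induce ({x}ᶜ : Set V))) : HasVertexMinor H G

section

variable {V : Type v} (G : SimpleGraph V)

/-- There is no edge between `A` and `B`. -/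
def AntiComplete (A B : Set V) : Prop := ∀ a ∈ A, ∀ b ∈ B, ¬ G.Adj a b

/-- Every vertex of `B` has a neighbour in `A`. -/
def Covers (A B : Set V) : Prop := ∀ b ∈ B, ∃ a ∈ A, G.Adj a b

/-- `N(A)`: the vertices outside `A` that are adjacent to a vertex of `A`. -/
def neighbourhood (A : Set V) : Set V := {x | x ∉ A ∧ ∃ a ∈ A, G.Adj a x}

/-- `P` is the vertex set of an induced path of `G` (with at least one vertex). -/
def IsInducedPath (P : Set V) : Prop :=
  ∃ n : ℕ, Nonempty (SimpleGraph.pathGraph (n + 1) ≃g G.induce P)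

/-- The induced path with vertex set `P` dangles from `X`. -/
def Dangles (P X : Set V) : Prop := IsInducedPath G P ∧ neighbourhood G P = X

/-- The path `P` dangles from `X`, and the vertices of `X` are pairwise at distance at least `6`
(vertices in different components are at infinite distance). -/
def DanglesSpaciously (P X : Set V) : Prop :=
  Dangles G P X ∧ X.Pairwise fun x y => 6 ≤ G.edist x y

/-- `(L 0, L 1, L 2, L 3)` is a long cover of `C`. -/
structure IsLongCover (L : Fin 4 → Set V) (C : Set V) : Prop where
  disjoint : Pairwise fun a b => Disjoint (L a) (L b)
  disjoint_target : ∀ a, Disjoint (L a) C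
  connected : (G.induce (L 0)).Connected
  covers : ∀ a : Fin 3, Covers G (L a.castSucc) (L a.succ)
  covers_target : Covers G (L 3) C
  anti_target : ∀ a : Fin 3, AntiComplete G C (L a.castSucc)
  anti : ∀ a b : Fin 4, (a : ℕ) + 1 < b → AntiComplete G (L a) (L b)

/-- `(L i : i < q)` is a long `q`-cover of `C`. -/
structure IsLongMultiCover {q : ℕ} (L : Fin q → Fin 4 → Set V) (C : Set V) : Prop where
  longCover : ∀ i, IsLongCover G (L i) C
  disjoint : Pairwise fun i j => Disjoint (⋃ a, L i a) (⋃ a, L j a)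
  anti : ∀ i j, i < j →
    AntiComplete G (L j 0 ∪ L j 1 ∪ L j 2) (L i 0 ∪ L i 1 ∪ L i 2 ∪ L i 3)

/-- The vertices of a long `q`-cover together with those of the paths `P j`. -/
def coverAndPaths {q h : ℕ} (L : Fin q → Fin 4 → Set V) (P : Fin h → Set V) : Set V :=
  (⋃ i, ⋃ a, L i a) ∪ ⋃ j, P j

/-- The induced paths with vertex sets `P j` (`j < h`) dangle spaciously from the long `q`-cover
`(L i : i < q)`. -/
structure PathsDangleSpaciously {q h : ℕ} (L : Fin q → Fin 4 → Set V) (P : Fin h → Set V) :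
    Prop where
  isInducedPath : ∀ j, IsInducedPath G (P j)
  disjoint_cover : ∀ j i a, Disjoint (P j) (L i a)
  disjoint : Pairwise fun j k => Disjoint (P j) (P k)
  anti : Pairwise fun j k => AntiComplete G (P j) (P k)
  exists_ends : ∃ m : Fin q → Fin h → V,
    (Pairwise fun s t : Fin q × Fin h => 6 ≤ G.edist (m s.1 s.2) (m t.1 t.2)) ∧
    (∀ i j, m i j ∈ L i 3) ∧
    ∀ j, DanglesSpaciously (G.induce (coverAndPaths L P))
      (Subtype.val ⁻¹' P j) (Subtype.val ⁻¹' Set.range fun i => m i j)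

end

end VMinor

/-! Everything is computed over `ZMod 2`. Suppose vertices `Z a` (`a` in `W`) and many pairwise
anti-complete connected sets (rows) are given, and each row contains, for each `a`, a vertex whose
only neighbour among the `Z` is `Z a`. Local complementation along an induced path of a row alters
the graph on the `Z` by a "layer" that depends only on the path. The layers of the subpaths of a
path between the private attachments of `Z a` and `Z b` generate the single edge `ab`, so each row
generates every graph on `W` (`edgeLayer_mem`, `mem_of_edgeLayer_mem`). To use only one path per
row, a growth argument in the finite group of matrices shows that with enough rows every target is a
sum of one layer from each row (`exists_sum_eq_of_mem_closure`). Hence `H` is a vertex-minor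
(`hasVertexMinor_of_rows`).

Such a configuration is found by Ramsey's theorem. After passing to a homogeneous set of indices, in
each column `w` either every end `m j w` has a neighbour in `L i 0` for all `i < j`, or none has. If
many columns are of the first kind, the rows are the sets `L i 0` and the `Z` are the ends at the
largest index (`hasVertexMinor_of_attached`). Otherwise each dangling path of the second kind is
contracted to a star whose centre serves as `Z w`, and the rows are the sets `L i 0` extended by
legs to the ends `m i w` (`exists_of_unattached`). The distance condition keeps attachments private
and rows anti-complete. -/

namespace VMinor

universe u v w

/-! ### Closure properties of vertex-minors -/

section Basic

variable {W : Type w} {H : SimpleGraph W}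

/-- Isomorphic graphs have the same vertex-minors. -/
theorem HasVertexMinor.of_iso {V V' : Type v} {G : SimpleGraph V} {G' : SimpleGraph V'}
    (e : G ≃g G') (h : HasVertexMinor H G') : HasVertexMinor H G := by
  induction h generalizing V with
  | iso f => exact .iso (e.trans f)
  | @localComplement V' G' x h ih =>
    refine .localComplement (e.symm x) (ih ⟨e.toEquiv, ?_⟩)
    intro a b
    have h1 := e.map_adj_iff (v := e.symm x) (w := a)
    have h2 := e.map_adj_iff (v := e.symm x) (w := b)
    have h3 := e.map_adj_iff (v := a) (w := b)
    rw [RelIso.apply_symm_apply] at h1 h2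
    simp only [VMinor.localComplement, ne_eq]
    erw [h1, h2, h3, e.toEquiv.apply_eq_iff_eq]
  | @deleteVertex V' G' x h ih =>
    refine .deleteVertex (e.symm x) (ih ⟨e.toEquiv.subtypeEquiv ?_, ?_⟩)
    · intro a
      simp only [Set.mem_compl_iff, Set.mem_singleton_iff]
      exact not_congr (by rw [← e.apply_eq_iff_eq, e.apply_symm_apply]; rfl)
    · intro a b
      exact e.map_adj_iff

variable {V : Type v} {G : SimpleGraph V}

theorem HasVertexMinor.of_induce_diff_singleton {U : Set V} {x : V} (hx : x ∈ U)
    (h : HasVertexMinor H (G.induce (U \ {x}))) : HasVertexMinor H (G.induce U) := by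
  refine .deleteVertex ⟨x, hx⟩ (h.of_iso ⟨⟨fun a => ⟨a.1.1, a.1.2, fun e => a.2 (Subtype.ext e)⟩,
    fun a => ⟨⟨a.1, a.2.1⟩, fun e => a.2.2 (congrArg Subtype.val e)⟩, fun _ => rfl, fun _ => rfl⟩,
    Iff.rfl⟩)

theorem HasVertexMinor.of_induce_subset [Finite V] {U U' : Set V} (hU : U' ⊆ U)
    (h : HasVertexMinor H (G.induce U')) : HasVertexMinor H (G.induce U) := by
  have key : ∀ D : Set V, HasVertexMinor H (G.induce (U \ D)) → HasVertexMinor H (G.induce U) := by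
    intro D
    induction D, D.toFinite using Set.Finite.induction_on with
    | empty => intro h; rwa [Set.sdiff_empty] at h
    | @insert x D _ _ ih =>
      intro h
      apply ih
      by_cases hx : x ∈ U \ D
      · apply HasVertexMinor.of_induce_diff_singleton hx
        rwa [Set.sdiff_sdiff, Set.union_singleton]
      · rw [← Set.union_singleton, ← Set.sdiff_sdiff, Set.sdiff_singleton_eq_self hx] at h
        exact h
  exact key (U \ U') (by rwa [Set.sdiff_sdiff_cancel_left hU])

theorem HasVertexMinor.of_induce [Finite V] {U : Set V}
    (h : HasVertexMinor H (G.induce U)) : HasVertexMinor H G :=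
  (h.of_induce_subset (Set.subset_univ U)).of_iso (SimpleGraph.induceUnivIso G).symm

theorem HasVertexMinor.of_induce_localComplement {U : Set V} {x : V} (hx : x ∈ U)
    (h : HasVertexMinor H ((VMinor.localComplement G x).induce U)) :
    HasVertexMinor H (G.induce U) := by
  refine .localComplement ⟨x, hx⟩ (h.of_iso ⟨Equiv.refl _, ?_⟩)
  intro a b
  simp [VMinor.localComplement, Subtype.ext_iff]

/-- Local complementation at the vertices of a list, in order. -/
def localComplements (G : SimpleGraph V) : List V → SimpleGraph V
  | [] => G
  | x :: l => localComplements (VMinor.localComplement G x) l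

theorem localComplements_append (G : SimpleGraph V) (l l' : List V) :
    localComplements G (l ++ l') = localComplements (localComplements G l) l' := by
  induction l generalizing G with
  | nil => rfl
  | cons x l ih => exact ih _

theorem HasVertexMinor.of_induce_localComplements {U : Set V} {l : List V} (hl : ∀ x ∈ l, x ∈ U)
    (h : HasVertexMinor H ((localComplements G l).induce U)) : HasVertexMinor H (G.induce U) := by
  induction l generalizing G with
  | nil => exact h
  | cons x l ih =>
    exact .of_induce_localComplement (hl x (by simp)) (ih (fun y hy => hl y (by simp [hy])) h)

/-- A graph is a vertex-minor of every graph containing it as the subgraph induced on the range of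
an embedding. -/
theorem HasVertexMinor.of_induce_range {Z : W → V} (hZ : Function.Injective Z)
    (h : ∀ a b, a ≠ b → (G.Adj (Z a) (Z b) ↔ H.Adj a b)) :
    HasVertexMinor H (G.induce (Set.range Z)) := by
  refine .iso (SimpleGraph.Iso.symm ⟨Equiv.ofInjective Z hZ, ?_⟩)
  intro a b
  by_cases hab : a = b
  · subst hab; simp
  · exact h a b hab

end Basic

/-! ### Adjacency over the field with two elements and the locality of local complementation -/

section Indicator

variable {V : Type v} (G : SimpleGraph V)

/-- The adjacency matrix modulo two. -/
noncomputable def ind (x y : V) : ZMod 2 := open Classical in if G.Adj x y then 1 else 0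

variable {G} {G' : SimpleGraph V} {x y p : V}

theorem ind_eq_one : ind G x y = 1 ↔ G.Adj x y := by
  by_cases h : G.Adj x y <;> simp [ind, h]

theorem ind_eq_zero : ind G x y = 0 ↔ ¬ G.Adj x y := by
  by_cases h : G.Adj x y <;> simp [ind, h]

theorem ind_comm (x y : V) : ind G x y = ind G y x := by
  by_cases h : G.Adj x y
  · simp [ind, h, h.symm]
  · have h' : ¬ G.Adj y x := fun e => h e.symm
    simp [ind, h, h']

theorem ind_self (x : V) : ind G x x = 0 := by simp [ind]

theorem ind_congr {x' y' : V} (h : G.Adj x y ↔ G'.Adj x' y') : ind G x y = ind G' x' y' := by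
  by_cases h' : G.Adj x y
  · simp [ind, h', h.1 h']
  · have h'' : ¬ G'.Adj x' y' := fun e => h' (h.2 e)
    simp [ind, h', h'']

theorem adj_iff_of_ind_eq {V' : Type*} {G' : SimpleGraph V'} {x' y' : V'}
    (h : ind G x y = ind G' x' y') : G.Adj x y ↔ G'.Adj x' y' := by
  rw [← ind_eq_one, h, ind_eq_one]

theorem ind_localComplement (hxy : x ≠ y) :
    ind (localComplement G p) x y = ind G x y + ind G p x * ind G p y := by
  have h2 : (1 : ZMod 2) + 1 = 0 := rfl
  by_cases h : G.Adj x y <;> by_cases hx : G.Adj p x <;> by_cases hy : G.Adj p y <;>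
    simp [ind, localComplement, Xor, h, hx, hy, hxy, h2]

theorem localComplement_adj_of_not_adj (hx : ¬ G.Adj p x) :
    (localComplement G p).Adj x y ↔ G.Adj x y := by
  simp only [localComplement, Xor]
  have := G.ne_of_adj (a := x) (b := y)
  tauto

/-- Vertices without a neighbour in `l` keep their neighbours under local complementation at
`l`. -/
theorem localComplements_adj_of_not_adj {l : List V} (hx : ∀ p ∈ l, ¬ G.Adj p x) :
    (localComplements G l).Adj x y ↔ G.Adj x y := by
  induction l generalizing G with
  | nil => rfl
  | cons p l ih =>
    have hp := hx p (by simp)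
    refine (ih fun q hq => ?_).trans (localComplement_adj_of_not_adj hp)
    rw [SimpleGraph.adj_comm, localComplement_adj_of_not_adj hp, SimpleGraph.adj_comm]
    exact hx q (by simp [hq])

/-- If the vertices of `P` have their neighbours in `C` then local complementation at vertices of
`P` only changes pairs inside `C`. -/
theorem localComplements_adj_of_local {U P C : Set V} (hPU : P ⊆ U)
    (hC : ∀ p ∈ P, ∀ x ∈ U, G.Adj p x → x ∈ C) {l : List V} (hl : ∀ p ∈ l, p ∈ P)
    (hx : x ∈ U) (hy : y ∈ U) (hxy : ¬ (x ∈ C ∧ y ∈ C)) :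
    (localComplements G l).Adj x y ↔ G.Adj x y := by
  induction l generalizing G with
  | nil => rfl
  | cons p l ih =>
    have hp : p ∈ P := hl p (by simp)
    have step : ∀ x ∈ U, ∀ y ∈ U, ¬ (x ∈ C ∧ y ∈ C) →
        ((localComplement G p).Adj x y ↔ G.Adj x y) := by
      intro x hx y hy hxy
      simp only [localComplement, Xor]
      have h1 := hC p hp x hx
      have h2 := hC p hp y hy
      have h3 := G.ne_of_adj (a := x) (b := y)
      tauto
    refine (ih (G := localComplement G p) ?_ fun q hq => hl q (by simp [hq])).trans
      (step x hx y hy hxy)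
    intro q hq x hx hqx
    by_contra hxC
    rw [step q (hPU hq) x hx (fun h => hxC h.2)] at hqx
    exact hxC (hC q hq x hx hqx)

end Indicator

/-! ### Induced paths as lists -/

section InducedPath

variable {V : Type v} {G G' : SimpleGraph V}

/-- The list `l` traverses an induced path. -/
def IsIndPath (G : SimpleGraph V) : List V → Prop
  | [] => True
  | p :: l => p ∉ l ∧ (∀ q ∈ l.head?, G.Adj p q) ∧ (∀ q ∈ l.tail, ¬ G.Adj p q) ∧ IsIndPath G l

theorem IsIndPath.congr {l : List V} (h : ∀ x ∈ l, ∀ y ∈ l, G.Adj x y ↔ G'.Adj x y)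
    (hl : IsIndPath G l) : IsIndPath G' l := by
  induction l with
  | nil => trivial
  | cons p l ih =>
    refine ⟨hl.1, fun q hq => ?_, fun q hq => ?_,
      ih (fun x hx y hy => h x (by simp [hx]) y (by simp [hy])) hl.2.2.2⟩
    · exact (h p (by simp) q (by simp [List.mem_of_mem_head? hq])).1 (hl.2.1 q hq)
    · rw [← h p (by simp) q (by simp [List.mem_of_mem_tail hq])]
      exact hl.2.2.1 q hq

theorem IsIndPath.of_append_left {l l' : List V} (h : IsIndPath G (l ++ l')) : IsIndPath G l := by
  induction l with
  | nil => trivial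
  | cons p l ih =>
    refine ⟨fun hp => h.1 (by simp [hp]), ?_, ?_, ih h.2.2.2⟩
    · cases l with
      | nil => simp
      | cons q l => exact h.2.1
    · cases l with
      | nil => simp
      | cons q l => exact fun r hr => h.2.2.1 r (by simpa using Or.inl hr)

theorem IsIndPath.of_append_right {l l' : List V} (h : IsIndPath G (l ++ l')) :
    IsIndPath G l' := by
  induction l with
  | nil => exact h
  | cons p l ih => exact ih h.2.2.2

theorem IsIndPath.nodup {l : List V} (h : IsIndPath G l) : l.Nodup := by
  induction l with
  | nil => simp
  | cons p l ih => exact List.nodup_cons.2 ⟨h.1, ih h.2.2.2⟩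

/-- A vertex on, or with a neighbour on, an induced path is the first vertex of an induced path
to the same end. -/
theorem IsIndPath.exists_cons {l : List V} {x b : V} (h : IsIndPath G l)
    (hb : b ∈ l.getLast?) (hx : x ∈ l ∨ ∃ y ∈ l, G.Adj x y) :
    ∃ l', IsIndPath G (x :: l') ∧ (∀ y ∈ l', y ∈ l) ∧ b ∈ (x :: l').getLast? := by
  induction l with
  | nil => simp at hx
  | cons p l ih =>
    -- The path is entered at the contact with `x` nearest to its end `b`, so that `x` has no
    -- further neighbour beyond it.
    by_cases hl : x ∈ l ∨ ∃ y ∈ l, G.Adj x y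
    · have hne : l ≠ [] := by rintro rfl; simp at hl
      obtain ⟨l', h1, h2, h3⟩ := ih h.2.2.2 (by
        rwa [List.getLast?_cons_of_ne_nil hne] at hb) hl
      exact ⟨l', h1, fun y hy => by simp [h2 y hy], h3⟩
    · by_cases hxp : x = p
      · subst hxp
        exact ⟨l, h, fun y hy => by simp [hy], hb⟩
      · have hadj : G.Adj x p := by
          rcases hx with hx | ⟨y, hy, hxy⟩
          · rcases List.mem_cons.1 hx with h | h
            · exact absurd h hxp
            · exact absurd (Or.inl h) hl
          · rcases List.mem_cons.1 hy with h | h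
            · exact h ▸ hxy
            · exact absurd (Or.inr ⟨y, h, hxy⟩) hl
        refine ⟨p :: l, ⟨?_, ?_, ?_, h⟩, fun y hy => hy, ?_⟩
        · intro hm
          rcases List.mem_cons.1 hm with h | h
          · exact hxp h
          · exact hl (Or.inl h)
        · simpa using hadj
        · exact fun q hq hxq => hl (Or.inr ⟨q, hq, hxq⟩)
        · rwa [List.getLast?_cons_of_ne_nil (by simp)]

/-- Two vertices connected inside `S` are the ends of an induced path inside `S`. -/
theorem exists_isIndPath_of_reachable {S : Set V} {x y : S} (h : (G.induce S).Reachable x y) :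
    ∃ l, IsIndPath G (x.1 :: l) ∧ (∀ z ∈ x.1 :: l, z ∈ S) ∧ y.1 ∈ (x.1 :: l).getLast? := by
  obtain ⟨c⟩ := h
  induction c with
  | nil => exact ⟨[], ⟨by simp, by simp, by simp, trivial⟩, by simp, by simp⟩
  | @cons a b c hab _ ih =>
    obtain ⟨l, h1, h2, h3⟩ := ih
    obtain ⟨l', h1', h2', h3'⟩ := h1.exists_cons h3 (Or.inr ⟨b.1, by simp, hab⟩)
    refine ⟨l', h1', fun z hz => ?_, h3'⟩
    rcases List.mem_cons.1 hz with rfl | hz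
    · exact a.2
    · exact h2 z (h2' z hz)

/-- The vertices of an induced path can be listed in order. -/
theorem IsInducedPath.exists_list {P : Set V} (h : IsInducedPath G P) :
    ∃ p l, IsIndPath G (p :: l) ∧ ∀ x, x ∈ p :: l ↔ x ∈ P := by
  obtain ⟨n, ⟨e⟩⟩ := h
  have key : ∀ (n : ℕ) (f : Fin n → V), Function.Injective f →
      (∀ s t : Fin n, G.Adj (f s) (f t) ↔ s.1 + 1 = t.1 ∨ t.1 + 1 = s.1) →
      IsIndPath G (List.ofFn f) := by
    intro n
    induction n with
    | zero => intro f _ _; simp [IsIndPath]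
    | succ n ih =>
      intro f hf hadj
      rw [List.ofFn_succ]
      refine ⟨?_, ?_, ?_, ih _ (hf.comp (Fin.succ_injective n)) fun s t => ?_⟩
      · rw [List.mem_ofFn]
        rintro ⟨s, hs⟩
        exact Fin.succ_ne_zero s (hf hs)
      · cases n with
        | zero => simp
        | succ n =>
          rw [List.ofFn_succ]
          simp [hadj]
      · cases n with
        | zero => simp
        | succ n =>
          rw [List.ofFn_succ, List.tail_cons]
          intro q hq
          rw [List.mem_ofFn] at hq
          obtain ⟨s, rfl⟩ := hq
          simp [hadj]
      · rw [hadj]; simp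
  refine ⟨(e 0).1, List.ofFn fun s : Fin n => (e s.succ).1, ?_, ?_⟩
  · have := key (n + 1) (fun s => (e s).1) (Subtype.val_injective.comp e.injective) (by
      intro s t
      have := e.map_adj_iff (v := s) (w := t)
      rw [SimpleGraph.pathGraph_adj] at this
      exact this)
    rwa [List.ofFn_succ] at this
  · intro x
    have : (e 0).1 :: List.ofFn (fun s : Fin n => (e s.succ).1) =
      List.ofFn fun s : Fin (n + 1) => (e s).1 := by rw [List.ofFn_succ]
    rw [this, List.mem_ofFn]
    constructor
    · rintro ⟨s, rfl⟩; exact (e s).2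
    · intro hx
      exact ⟨e.symm ⟨x, hx⟩, by simp⟩

end InducedPath

/-! ### Layers of induced paths and the graphs they generate -/

section Layer

/-- The sum of the products of the prefix sums of two sequences, with initial values. -/
def prefixProducts : ZMod 2 → ZMod 2 → List (ZMod 2 × ZMod 2) → ZMod 2
  | _, _, [] => 0
  | c, d, u :: l => (c + u.1) * (d + u.2) + prefixProducts (c + u.1) (d + u.2) l

theorem prefixProducts_concat (c d : ZMod 2) (l : List (ZMod 2 × ZMod 2)) (u : ZMod 2 × ZMod 2) :
    prefixProducts c d (l ++ [u]) = prefixProducts c d l +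
      (c + ((l.map Prod.fst).sum + u.1)) * (d + ((l.map Prod.snd).sum + u.2)) := by
  induction l generalizing c d with
  | nil => simp [prefixProducts]
  | cons a l ih =>
    simp only [List.cons_append, prefixProducts, ih, List.map_cons, List.sum_cons]
    ring

variable {V : Type v} {G : SimpleGraph V} {W : Type w}

/-- Complementing at `p` adds the outside neighbourhood of `p` to that of the next vertex `q` and
leaves those of later path vertices alone. So the set complemented at each step is the sum of the
neighbourhoods of all path vertices so far, which gives products of prefix sums. -/
theorem ind_localComplements_cons (l : List V) (G : SimpleGraph V) (p : V)
    (hl : IsIndPath G (p :: l)) {x y : V} (hxy : x ≠ y) (hx : x ∉ p :: l) (hy : y ∉ p :: l) :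
    ind (localComplements G (p :: l)) x y = ind G x y + ind G p x * ind G p y +
      prefixProducts (ind G p x) (ind G p y) (l.map fun r => (ind G r x, ind G r y)) := by
  induction l generalizing G p with
  | nil => simp [localComplements, ind_localComplement hxy, prefixProducts]
  | cons q l ih =>
    have hpq : G.Adj p q := hl.2.1 q (by simp)
    have hpl : ∀ r ∈ l, ind G p r = 0 := fun r hr => ind_eq_zero.2 (hl.2.2.1 r hr)
    have hne : ∀ z, z ∉ p :: q :: l → ∀ r ∈ q :: l, r ≠ z :=
      fun z hz r hr e => hz (by rw [← e]; simp [List.mem_cons.1 hr])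
    -- On the remaining path `p` has the single neighbour `q`, so no pair there is toggled.
    have hpath : IsIndPath (localComplement G p) (q :: l) := by
      refine hl.2.2.2.congr fun a ha b hb => ?_
      have ha' : G.Adj p a → a = q := fun h => (List.mem_cons.1 ha).resolve_right
        fun h' => hl.2.2.1 a h' h
      have hb' : G.Adj p b → b = q := fun h => (List.mem_cons.1 hb).resolve_right
        fun h' => hl.2.2.1 b h' h
      simp only [localComplement, Xor]
      have := G.ne_of_adj (a := a) (b := b)
      have : G.Adj p a → G.Adj p b → a = b := fun h h' => (ha' h).trans (hb' h').symm
      tauto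
    have hq : ∀ z, z ∉ p :: q :: l →
        ind (localComplement G p) q z = ind G p z + ind G q z := fun z hz => by
      rw [ind_localComplement (hne z hz q (by simp)), ind_eq_one.2 hpq]; ring
    have hmap : (l.map fun r => (ind (localComplement G p) r x, ind (localComplement G p) r y)) =
        l.map fun r => (ind G r x, ind G r y) := by
      refine List.map_congr_left fun r hr => ?_
      rw [ind_localComplement (hne x hx r (by simp [hr])),
        ind_localComplement (hne y hy r (by simp [hr])), hpl r hr]
      simp
    have := ih (localComplement G p) q hpath (fun h => hx (List.mem_cons_of_mem _ h))
      (fun h => hy (List.mem_cons_of_mem _ h))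
    rw [localComplements, this, hmap, hq x hx, hq y hy, ind_localComplement hxy]
    simp only [List.map_cons, prefixProducts]
    ring

/-- Local complementation along an induced path. -/
theorem ind_localComplements {l : List V} (hl : IsIndPath G l) {x y : V} (hxy : x ≠ y)
    (hx : x ∉ l) (hy : y ∉ l) : ind (localComplements G l) x y = ind G x y +
      prefixProducts 0 0 (l.map fun r => (ind G r x, ind G r y)) := by
  cases l with
  | nil => simp [localComplements, prefixProducts]
  | cons p l =>
    rw [ind_localComplements_cons l G p hl hxy hx hy]
    simp only [List.map_cons, prefixProducts, zero_add]
    ring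

open Classical in
/-- The change of the adjacencies between the vertices `Z a` caused by local complementation
along the induced path `l`. -/
noncomputable def layer (G : SimpleGraph V) (Z : W → V) (l : List V) : W → W → ZMod 2 :=
  fun a b => if a = b then 0 else
    prefixProducts 0 0 (l.map fun r => (ind G r (Z a), ind G r (Z b)))

open Classical in
/-- The graph on `W` in which `a`, `b` are adjacent if each of them has an odd number of
neighbours in `l`. -/
noncomputable def squareLayer (G : SimpleGraph V) (Z : W → V) (l : List V) : W → W → ZMod 2 :=
  fun a b => if a = b then 0 else
    (l.map fun r => ind G r (Z a)).sum * (l.map fun r => ind G r (Z b)).sum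

open Classical in
/-- The graph with the single edge `ab`. -/
noncomputable def edgeLayer (a b : W) : W → W → ZMod 2 :=
  fun c d => if (c = a ∧ d = b) ∨ (c = b ∧ d = a) then 1 else 0

/-- The layers of a path and of the path without its last vertex differ by the last summand alone,
the product of the full sums. Thus rank-one updates become sums of layers. -/
theorem squareLayer_concat (G : SimpleGraph V) (Z : W → V) (l : List V) (p : V) :
    squareLayer G Z (l ++ [p]) = layer G Z (l ++ [p]) + layer G Z l := by
  ext a b
  by_cases hab : a = b
  · simp [squareLayer, layer, hab]
  · simp only [squareLayer, layer, hab, if_false, List.map_append, List.map_cons, List.map_nil,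
      prefixProducts_concat, Pi.add_apply, List.sum_append, List.sum_cons, List.sum_nil,
      List.map_map, Function.comp_def, zero_add, add_zero]
    generalize prefixProducts 0 0 _ = t
    have : t + t = 0 := CharTwo.add_self_eq_zero t
    linear_combination -this

theorem squareLayer_mem {Z : W → V} {F : AddSubmonoid (W → W → ZMod 2)} {l : List V}
    (h : ∀ l', l' <:+: l → layer G Z l' ∈ F) : squareLayer G Z l ∈ F := by
  rcases List.eq_nil_or_concat l with rfl | ⟨l, p, rfl⟩
  · convert F.zero_mem
    ext a b
    simp [squareLayer]
  · rw [List.concat_eq_append] at h ⊢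
    rw [squareLayer_concat]
    exact F.add_mem (h _ List.infix_rfl) (h _ (List.prefix_append l [p]).isInfix)

/-- The layers of the subpaths of a path whose ends attach only to `Z a` and to `Z b` generate the
edge `ab`. -/
theorem edgeLayer_mem {Z : W → V} {F : AddSubmonoid (W → W → ZMod 2)} {l : List V} {p q : V}
    {a b : W} (hab : a ≠ b) (hp : ∀ c, G.Adj p (Z c) ↔ c = a) (hq : ∀ c, G.Adj q (Z c) ↔ c = b)
    (h : ∀ l', l' <:+: p :: (l ++ [q]) → layer G Z l' ∈ F) : edgeLayer a b ∈ F := by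
  classical
  have hp' : ∀ c, ind G p (Z c) = if c = a then 1 else 0 := fun c => by
    split_ifs with hc
    · exact ind_eq_one.2 ((hp c).2 hc)
    · exact ind_eq_zero.2 (fun e => hc ((hp c).1 e))
  have hq' : ∀ c, ind G q (Z c) = if c = b then 1 else 0 := fun c => by
    split_ifs with hc
    · exact ind_eq_one.2 ((hq c).2 hc)
    · exact ind_eq_zero.2 (fun e => hc ((hq c).1 e))
  have i1 : p :: l <:+: p :: (l ++ [q]) := (List.prefix_append (p :: l) [q]).isInfix
  have i2 : l ++ [q] <:+: p :: (l ++ [q]) := (List.suffix_cons p _).isInfix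
  have i3 : l <:+: p :: (l ++ [q]) := (List.prefix_append l [q]).isInfix.trans i2
  -- Polarisation: with `s` the sum of the neighbourhood vectors along `l`, the squares of `e_a + s
  -- + e_b`, `e_a + s`, `s + e_b` and `s` add up modulo two to `e_a ⊗ e_b + e_b ⊗ e_a`.
  have key : edgeLayer a b = squareLayer G Z (p :: (l ++ [q])) + squareLayer G Z (p :: l) +
      squareLayer G Z (l ++ [q]) + squareLayer G Z l := by
    ext c d
    by_cases hcd : c = d
    · subst hcd
      have : ¬ (c = a ∧ c = b ∨ c = b ∧ c = a) := by rintro (⟨rfl, h⟩ | ⟨rfl, h⟩) <;> simp_all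
      simp [edgeLayer, squareLayer, this]
    · simp only [edgeLayer, squareLayer, hcd, if_false, List.map_append, List.map_cons,
        List.map_nil, Pi.add_apply, List.sum_append, List.sum_cons, List.sum_nil, hp', hq']
      generalize (l.map fun r => ind G r (Z c)).sum = s
      generalize (l.map fun r => ind G r (Z d)).sum = t
      have two : (2 : ZMod 2) = 0 := rfl
      have expand : ∀ s t x y x' y' : ZMod 2, (x + (s + (y + 0))) * (x' + (t + (y' + 0))) +
          (x + s) * (x' + t) + (s + (y + 0)) * (t + (y' + 0)) + s * t = x * y' + x' * y := by
        intro s t x y x' y'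
        linear_combination (x * x' + x * t + s * x' + 2 * s * t + s * y' + y * t + y * y') * two
      rw [expand]
      by_cases h1 : c = a ∧ d = b
      · obtain ⟨rfl, rfl⟩ := h1
        simp [hab, hab.symm]
      · by_cases h2 : c = b ∧ d = a
        · obtain ⟨rfl, rfl⟩ := h2
          simp [hab, hab.symm]
        · rw [if_neg (not_or.2 ⟨h1, h2⟩)]
          by_cases hc : c = a
          · have hd : d ≠ b := fun e => h1 ⟨hc, e⟩
            have hd' : d ≠ a := fun e => hcd (hc.trans e.symm)
            simp [hd, hd']
          · by_cases hd : d = a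
            · have hc' : c ≠ b := fun e => h2 ⟨e, hd⟩
              simp [hc, hc']
            · simp [hc, hd]
  rw [key]
  exact F.add_mem (F.add_mem (F.add_mem (squareLayer_mem h)
    (squareLayer_mem fun l' hl => h l' (hl.trans i1)))
    (squareLayer_mem fun l' hl => h l' (hl.trans i2)))
    (squareLayer_mem fun l' hl => h l' (hl.trans i3))

/-- Every graph is a sum of edges. -/
theorem mem_of_edgeLayer_mem [Finite W] {F : AddSubmonoid (W → W → ZMod 2)}
    (hF : ∀ a b, a ≠ b → edgeLayer a b ∈ F) {t : W → W → ZMod 2} (h0 : ∀ a, t a a = 0)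
    (hs : ∀ a b, t a b = t b a) : t ∈ F := by
  classical
  have := Fintype.ofFinite W
  -- An auxiliary order makes the double sum count each edge once.
  let _ : LinearOrder W := IsWellOrder.linearOrder WellOrderingRel
  have key : t = ∑ a, ∑ b, if a < b ∧ t a b = 1 then edgeLayer a b else 0 := by
    ext c d
    simp only [Finset.sum_apply]
    have one : ∀ x : ZMod 2, x = if x = 1 then 1 else 0 := by decide
    have hterm : ∀ a b, (if a < b ∧ t a b = 1 then edgeLayer a b else 0 : W → W → ZMod 2) c d =
        if (a = c ∧ b = d ∨ a = d ∧ b = c) ∧ a < b ∧ t c d = 1 then 1 else 0 := by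
      intro a b
      by_cases h1 : (a = c ∧ b = d ∨ a = d ∧ b = c)
      · have : t a b = t c d := by
          rcases h1 with ⟨rfl, rfl⟩ | ⟨rfl, rfl⟩
          · rfl
          · exact hs _ _
        rw [this]
        by_cases h2 : a < b ∧ t c d = 1
        · have h3 : (c = a ∧ d = b ∨ c = b ∧ d = a) := by
            rcases h1 with ⟨rfl, rfl⟩ | ⟨rfl, rfl⟩ <;> simp
          simp only [h2, h1, and_self, if_true, edgeLayer, h3]
        · simp only [h2, and_false, if_false, Pi.zero_apply]
      · have h3 : ¬ (c = a ∧ d = b ∨ c = b ∧ d = a) := by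
          rintro (⟨rfl, rfl⟩ | ⟨rfl, rfl⟩) <;> simp at h1
        simp only [h1, false_and, if_false]
        split_ifs <;> simp [edgeLayer, h3]
    simp only [hterm]
    rcases lt_trichotomy c d with h | rfl | h
    · rw [Finset.sum_eq_single c, Finset.sum_eq_single d]
      · rw [one (t c d)]; simp [h]
      · intro b _ hb
        rw [if_neg]
        rintro ⟨⟨-, rfl⟩ | ⟨rfl, -⟩, -⟩
        · exact hb rfl
        · exact lt_irrefl _ h
      · simp
      · intro a _ ha
        refine Finset.sum_eq_zero fun b _ => if_neg ?_
        rintro ⟨⟨rfl, -⟩ | ⟨rfl, rfl⟩, h', -⟩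
        · exact ha rfl
        · exact lt_asymm h h'
      · simp
    · simp [h0]
    · rw [Finset.sum_eq_single d, Finset.sum_eq_single c]
      · rw [one (t c d)]; simp [h]
      · intro b _ hb
        rw [if_neg]
        rintro ⟨⟨rfl, -⟩ | ⟨-, rfl⟩, -⟩
        · exact lt_irrefl _ h
        · exact hb rfl
      · simp
      · intro a _ ha
        refine Finset.sum_eq_zero fun b _ => if_neg ?_
        rintro ⟨⟨rfl, rfl⟩ | ⟨rfl, -⟩, h', -⟩
        · exact lt_asymm h h'
        · exact ha rfl
      · simp
  rw [key]
  refine F.sum_mem fun a _ => F.sum_mem fun b _ => ?_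
  split_ifs with h
  · exact hF a b h.1.ne
  · exact F.zero_mem

end Layer

/-! ### Sums of one member from each set -/

section Sumset

/-- A target in the span of each of sufficiently many sets is a sum of members of the sets. -/
theorem exists_sum_eq_of_mem_closure {M ι : Type*} [AddCommMonoid M] [Finite M]
    {F : ι → Set M} {s : Finset ι} {t : M} (h0 : ∀ i ∈ s, 0 ∈ F i)
    (ht : ∀ i ∈ s, t ∈ AddSubmonoid.closure (F i)) (hs : Nat.card M ≤ s.card) :
    ∃ f : ι → M, (∀ i ∈ s, f i ∈ F i) ∧ ∑ i ∈ s, f i = t := by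
  classical
  let B : Finset ι → Set M := fun s => {x | ∃ f : ι → M, (∀ i ∈ s, f i ∈ F i) ∧ ∑ i ∈ s, f i = x}
  -- Until the target is reached, each further set must enlarge the set `B` of attainable sums,
  -- which cannot outgrow `M`.
  suffices key : t ∈ B s ∨ s.card + 1 ≤ (B s).ncard by
    rcases key with h | h
    · exact h
    · have := Set.ncard_le_card (B s)
      omega
  clear hs
  induction s using Finset.induction_on with
  | empty =>
    right
    have : B ∅ = {0} := by
      ext x; simp [B, eq_comm]
    simp [this]
  | @insert i s hi ih =>
    have ext : ∀ x ∈ B s, ∀ y ∈ F i, x + y ∈ B (insert i s) := by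
      rintro x ⟨f, hf, rfl⟩ y hy
      refine ⟨Function.update f i y, ?_, ?_⟩
      · intro j hj
        by_cases hji : j = i
        · subst hji; simpa using hy
        · rw [Function.update_of_ne hji]
          exact hf j ((Finset.mem_insert.1 hj).resolve_left hji)
      · rw [Finset.sum_insert hi, Function.update_self, add_comm]
        congr 1
        refine Finset.sum_congr rfl fun j hj => Function.update_of_ne ?_ _ _
        rintro rfl; exact hi hj
    have hsub : B s ⊆ B (insert i s) := fun x hx => by
      simpa using ext x hx 0 (h0 i (by simp))
    have hzero : (0 : M) ∈ B s := ⟨0, fun j hj => h0 j (by simp [hj]), by simp⟩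
    have ht' := ht i (by simp)
    rcases ih (fun j hj => h0 j (by simp [hj])) (fun j hj => ht j (by simp [hj])) with h | h
    · exact Or.inl (hsub h)
    · by_cases hB : B (insert i s) ⊆ B s
      · left
        -- If `F i` adds nothing new, the attainable sums are stable under adding all of its
        -- closure; as they contain `0`, they contain `t`.
        have hcl : ∀ y ∈ AddSubmonoid.closure (F i), ∀ x ∈ B s, x + y ∈ B s := by
          intro y hy
          induction hy using AddSubmonoid.closure_induction with
          | mem y hy => exact fun x hx => hB (ext x hx y hy)
          | zero => simp
          | add y z _ _ ihy ihz => exact fun x hx => by rw [← add_assoc]; exact ihz _ (ihy x hx)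
        exact hsub (by simpa using hcl t ht' 0 hzero)
      · right
        rw [Finset.card_insert_of_notMem hi]
        have := Set.ncard_lt_ncard (⟨hsub, hB⟩)
          (Set.toFinite (B (insert i s)))
        omega

end Sumset

/-! ### Every graph from sufficiently many rows -/

section Rows

variable {V : Type v} {W : Type w} {ι : Type u} [Finite V] {H : SimpleGraph W}

/-- Eliminating pairwise anti-complete induced paths adds up their layers. -/
theorem hasVertexMinor_of_layers {Z : W → V} (hZ : Function.Injective Z) {U : Set V}
    (hZU : ∀ a, Z a ∈ U) {R : ι → Set V} {l : ι → List V} (s : Finset ι) (G : SimpleGraph V)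
    (hRU : ∀ i ∈ s, R i ⊆ U) (hl : ∀ i ∈ s, IsIndPath G (l i)) (hlR : ∀ i ∈ s, ∀ x ∈ l i, x ∈ R i)
    (hRZ : ∀ i ∈ s, ∀ a, Z a ∉ R i)
    (hR : ∀ i ∈ s, ∀ j ∈ s, i ≠ j → AntiComplete G (R i) (R j))
    (h : ∀ a b, a ≠ b →
      ind G (Z a) (Z b) + (∑ i ∈ s, layer G Z (l i)) a b = ind H a b) :
    HasVertexMinor H (G.induce U) := by
  classical
  induction s using Finset.induction_on generalizing G with
  | empty =>
    refine .of_induce_subset (Set.range_subset_iff.2 hZU) (.of_induce_range hZ fun a b hab => ?_)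
    exact adj_iff_of_ind_eq (by simpa using h a b hab)
  | @insert i s hi ih =>
    have hne : ∀ j ∈ s, j ≠ i := fun j hj e => hi (e ▸ hj)
    -- Vertices of the other rows have no neighbour on the eliminated path, so their adjacencies,
    -- and with them their layers, survive.
    have hinv : ∀ j ∈ s, ∀ x ∈ R j, ∀ y, (localComplements G (l i)).Adj x y ↔ G.Adj x y :=
      fun j hj x hx y => localComplements_adj_of_not_adj fun p hp =>
        hR i (by simp) j (by simp [hj]) (hne j hj).symm p (hlR i (by simp) p hp) x hx
    refine .of_induce_localComplements
      (fun x hx => hRU i (by simp) (hlR i (by simp) x hx)) (ih _ ?_ ?_ ?_ ?_ ?_ ?_)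
    · exact fun j hj => hRU j (by simp [hj])
    · exact fun j hj => (hl j (by simp [hj])).congr fun x hx y _ =>
        (hinv j hj x (hlR j (by simp [hj]) x hx) y).symm
    · exact fun j hj => hlR j (by simp [hj])
    · exact fun j hj => hRZ j (by simp [hj])
    · exact fun j hj k hk hjk x hx y hy hxy =>
        hR j (by simp [hj]) k (by simp [hk]) hjk x hx y hy ((hinv j hj x hx y).1 hxy)
    · intro a b hab
      rw [← h a b hab, Finset.sum_insert hi, ind_localComplements (hl i (by simp))
        (hZ.ne hab) (fun e => hRZ i (by simp) a (hlR i (by simp) _ e))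
        (fun e => hRZ i (by simp) b (hlR i (by simp) _ e)), Pi.add_apply, Pi.add_apply, add_assoc]
      congr 2
      · simp [layer, hab]
      · rw [Finset.sum_congr rfl fun j hj => ?_]
        ext c d
        unfold layer
        congr 2
        refine List.map_congr_left fun r hr => ?_
        rw [ind_congr (hinv j hj r (hlR j (by simp [hj]) r hr) (Z c)),
          ind_congr (hinv j hj r (hlR j (by simp [hj]) r hr) (Z d))]

/-- If sufficiently many pairwise anti-complete connected sets contain, for each of the vertices
`Z a`, a vertex whose only neighbour among these is `Z a`, then every graph on the index set is a
vertex-minor. -/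
theorem hasVertexMinor_of_rows [Finite W] {G : SimpleGraph V} {Z : W → V}
    (hZ : Function.Injective Z)
    {U : Set V} (hZU : ∀ a, Z a ∈ U) {R : ι → Set V} {s : Finset ι}
    (hs : Nat.card (W → W → ZMod 2) ≤ s.card) (hRU : ∀ i ∈ s, R i ⊆ U)
    (hRZ : ∀ i ∈ s, ∀ a, Z a ∉ R i)
    (hR : ∀ i ∈ s, ∀ j ∈ s, i ≠ j → AntiComplete G (R i) (R j))
    (hconn : ∀ i ∈ s, (G.induce (R i)).Preconnected)
    (hx : ∀ i ∈ s, ∀ a, ∃ x ∈ R i, ∀ c, G.Adj x (Z c) ↔ c = a) :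
    HasVertexMinor H (G.induce U) := by
  classical
  -- The target is the difference between `H` and the present graph on the `Z`. The empty path
  -- provides the zero layer, which permits leaving a row unused.
  obtain ⟨f, hf, hsum⟩ := exists_sum_eq_of_mem_closure (M := W → W → ZMod 2)
    (F := fun i => {t | ∃ l, IsIndPath G l ∧ (∀ x ∈ l, x ∈ R i) ∧ layer G Z l = t})
    (s := s) (t := fun a b => ind G (Z a) (Z b) + ind H a b)
    (fun i _ => ⟨[], trivial, by simp, by ext a b; simp [layer, prefixProducts]⟩)
    (fun i hi => by
      refine mem_of_edgeLayer_mem (fun a b hab => ?_) (fun a => by simp [ind_self])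
        fun a b => by rw [ind_comm, ind_comm a b]
      obtain ⟨x, hxR, hxa⟩ := hx i hi a
      obtain ⟨y, hyR, hyb⟩ := hx i hi b
      obtain ⟨l, hl, hlR, hlast⟩ := exists_isIndPath_of_reachable (hconn i hi ⟨x, hxR⟩ ⟨y, hyR⟩)
      rcases List.eq_nil_or_concat l with rfl | ⟨l, z, rfl⟩
      · have : x = y := by simpa using hlast
        exact absurd ((hyb a).1 (this ▸ (hxa a).2 rfl)) hab
      · rw [List.concat_eq_append] at hl hlR hlast
        have hzy : z = y := by simpa [List.getLast?_cons, List.getLast?_append] using hlast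
        subst hzy
        refine edgeLayer_mem (l := l) hab hxa hyb fun l' hl' => AddSubmonoid.subset_closure ?_
        obtain ⟨l1, l2, hl12⟩ := id hl'
        refine ⟨l', ?_, fun v hv => hlR v (hl'.subset hv), rfl⟩
        rw [← hl12] at hl
        exact hl.of_append_left.of_append_right)
    hs
  choose! l h1 h2 h3 using hf
  refine hasVertexMinor_of_layers hZ hZU s G hRU h1 h2 hRZ hR fun a b _ => ?_
  rw [Finset.sum_congr rfl h3, hsum]
  change ind G (Z a) (Z b) + (ind G (Z a) (Z b) + ind H a b) = _
  rw [← add_assoc, CharTwo.add_self_eq_zero, zero_add]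

end Rows

/-! ### Ramsey's theorem -/

section Ramsey

theorem exists_clique_or_independent (a b : ℕ) : ∃ N : ℕ, ∀ {ι : Type u} (r : ι → ι → Prop),
    (∀ i j, r i j → r j i) → ∀ s : Finset ι, N ≤ s.card →
      (∃ t ⊆ s, a ≤ t.card ∧ ∀ i ∈ t, ∀ j ∈ t, i ≠ j → r i j) ∨
      (∃ t ⊆ s, b ≤ t.card ∧ ∀ i ∈ t, ∀ j ∈ t, i ≠ j → ¬ r i j) := by
  induction a generalizing b with
  | zero => exact ⟨0, fun r _ s _ => Or.inl ⟨∅, by simp, by simp, by simp⟩⟩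
  | succ a iha =>
    induction b with
    | zero => exact ⟨0, fun r _ s _ => Or.inr ⟨∅, by simp, by simp, by simp⟩⟩
    | succ b ihb =>
      obtain ⟨N₁, h₁⟩ := iha (b + 1)
      obtain ⟨N₂, h₂⟩ := ihb
      -- One vertex `x` is the pivot; the others split into those related to `x` and those not, and
      -- one part is large enough for induction.
      refine ⟨N₁ + N₂ + 1, fun {ι} r hr s hs => ?_⟩
      classical
      obtain ⟨x, hx⟩ : s.Nonempty := Finset.card_pos.1 (by omega)
      have hcard := Finset.card_filter_add_card_filter_not (s := s.erase x) (r x)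
      rw [Finset.card_erase_of_mem hx] at hcard
      have hxt : ∀ (P : ι → Prop) [DecidablePred P] (t : Finset ι),
          t ⊆ (s.erase x).filter P → x ∉ t ∧ t ⊆ s ∧ ∀ i ∈ t, P i := fun P _ t ht => ⟨fun h => by simpa using ht h,
        fun i hi => Finset.mem_of_mem_erase (Finset.mem_filter.1 (ht hi)).1,
        fun i hi => (Finset.mem_filter.1 (ht hi)).2⟩
      have hins : ∀ (Q : ι → ι → Prop), (∀ i j, Q i j → Q j i) → ∀ t : Finset ι,
          (∀ i ∈ t, Q x i) → (∀ i ∈ t, ∀ j ∈ t, i ≠ j → Q i j) →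
          ∀ i ∈ insert x t, ∀ j ∈ insert x t, i ≠ j → Q i j := by
        intro Q hQ t h1 h2 i hi j hj hij
        rcases Finset.mem_insert.1 hi with hix | hi' <;>
          rcases Finset.mem_insert.1 hj with hjx | hj'
        · exact absurd (hix.trans hjx.symm) hij
        · exact hix ▸ h1 j hj'
        · exact hjx ▸ hQ _ _ (h1 i hi')
        · exact h2 i hi' j hj' hij
      by_cases hN : N₁ ≤ ((s.erase x).filter (r x)).card
      · rcases h₁ r hr _ hN with ⟨t, ht, hta, htr⟩ | ⟨t, ht, htb, htr⟩
        · obtain ⟨hx', hts, hrx⟩ := hxt _ t ht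
          exact Or.inl ⟨insert x t, Finset.insert_subset hx hts,
            by rw [Finset.card_insert_of_notMem hx']; omega, hins r hr t hrx htr⟩
        · exact Or.inr ⟨t, (hxt _ t ht).2.1, htb, htr⟩
      · rcases h₂ r hr ((s.erase x).filter fun i => ¬ r x i) (by omega) with
          ⟨t, ht, hta, htr⟩ | ⟨t, ht, htb, htr⟩
        · exact Or.inl ⟨t, (hxt _ t ht).2.1, hta, htr⟩
        · obtain ⟨hx', hts, hrx⟩ := hxt _ t ht
          exact Or.inr ⟨insert x t, Finset.insert_subset hx hts,
            by rw [Finset.card_insert_of_notMem hx']; omega,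
            hins (fun i j => ¬ r i j) (fun i j h h' => h (hr j i h')) t hrx htr⟩

end Ramsey

/-! ### Contracting a path with attached vertices to a star -/

section Contraction

variable {V : Type v} {G : SimpleGraph V}

open Classical in
/-- An induced path may be eliminated up to its first vertex so that this collects the
neighbourhoods of all vertices of the path except for those satisfying `sk`. -/
theorem exists_localComplements_sum (sk : V → Prop) (l : List V) (p : V)
    (hl : IsIndPath G (p :: l))
    (hsk : ∀ q l', q :: l' <:+ l → sk q → ∃ r ∈ l'.head?, ¬ sk r) :
    ∃ σ : List V, (∀ x ∈ σ, x ∈ l) ∧ ∀ x, x ∉ p :: l →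
      ind (localComplements G σ) p x =
        ind G p x + (l.map fun r => if sk r then 0 else ind G r x).sum := by
  match l with
  | [] => exact ⟨[], by simp, by simp [localComplements]⟩
  | q :: l =>
    have hpq : ind G p q = 1 := ind_eq_one.2 (hl.2.1 q (by simp))
    by_cases hq : sk q
    -- To skip `q`, the tail is first collected at its successor `r'`, and then `q` and `r'` are
    -- complemented in this order. The neighbourhood of `q` reaches `p` once directly and once
    -- through `r'`, and cancels.
    · obtain ⟨r, hr, hskr⟩ := hsk q l List.suffix_rfl hq
      match l with
      | [] => simp at hr
      | r' :: l =>
        obtain rfl : r' = r := by simpa using hr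
        obtain ⟨σ, hσ, h⟩ := exists_localComplements_sum sk l r' hl.2.2.2.2.2.2
          fun a l' hal => hsk a l' (hal.trans ((List.suffix_cons _ _).trans (List.suffix_cons _ _)))
        have hqr : ind G q r' = 1 := ind_eq_one.2 (hl.2.2.2.2.1 r' (by simp))
        have hpr : ind G p r' = 0 := ind_eq_zero.2 (hl.2.2.1 r' (by simp))
        have e1 : ∀ y, ind (localComplements G σ) p y = ind G p y := fun y =>
          ind_congr (localComplements_adj_of_not_adj fun a ha e =>
            hl.2.2.1 a (by simp [hσ a ha]) e.symm)
        have e2 : ∀ y, ind (localComplements G σ) q y = ind G q y := fun y =>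
          ind_congr (localComplements_adj_of_not_adj fun a ha e =>
            hl.2.2.2.2.2.1 a (hσ a ha) e.symm)
        refine ⟨σ ++ [q, r'], ?_, fun x hx => ?_⟩
        · intro x hx
          simp only [List.mem_append, List.mem_cons, List.not_mem_nil, or_false] at hx ⊢
          rcases hx with hx | hx | hx
          · exact Or.inr (Or.inr (hσ x hx))
          · exact Or.inl hx
          · exact Or.inr (Or.inl hx)
        · simp only [List.mem_cons, not_or] at hx
          obtain ⟨hxp, hxq, hxr, hxl⟩ := hx
          have hrp : r' ≠ p := fun e => hl.1 (by simp [e])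
          rw [localComplements_append]
          simp only [localComplements]
          rw [ind_localComplement (Ne.symm hxp), ind_localComplement (Ne.symm hxp),
            ind_localComplement hrp, ind_localComplement (Ne.symm hxr), e1, e2, e2, e2,
            ind_comm r' p, e1, ind_comm q p, hpq, hqr, hpr, h x (by simp [hxr, hxl])]
          simp only [List.map_cons, List.sum_cons, hq, hskr, if_true, if_false]
          have two : (2 : ZMod 2) = 0 := rfl
          linear_combination ind G q x * two
    · obtain ⟨σ, hσ, h⟩ := exists_localComplements_sum sk l q hl.2.2.2
        fun a l' hal => hsk a l' (hal.trans (List.suffix_cons _ _))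
      have e1 : ∀ y, ind (localComplements G σ) p y = ind G p y := fun y =>
        ind_congr (localComplements_adj_of_not_adj fun a ha e => hl.2.2.1 a (hσ a ha) e.symm)
      refine ⟨σ ++ [q], ?_, fun x hx => ?_⟩
      · intro x hx
        simp only [List.mem_append, List.mem_cons, List.not_mem_nil, or_false] at hx ⊢
        exact hx.elim (fun hx => Or.inr (hσ x hx)) Or.inl
      · simp only [List.mem_cons, not_or] at hx
        obtain ⟨hxp, hxq, hxl⟩ := hx
        rw [localComplements_append]
        simp only [localComplements]
        rw [ind_localComplement (Ne.symm hxp), ind_comm q p, e1, e1, hpq, h x (by simp [hxq, hxl])]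
        simp only [List.map_cons, List.sum_cons, hq, if_false]
        ring
termination_by l.length

theorem sum_map_ite_add {f : V → ZMod 2} [DecidableEq V] {l : List V} (hl : l.Nodup) {q : V}
    (hq : q ∈ l) : (l.map fun r => if r = q then 0 else f r).sum + f q = (l.map f).sum := by
  obtain ⟨l1, l2, rfl⟩ := List.append_of_mem hq
  have h1 : ∀ r ∈ l1, r ≠ q := by
    rintro r hr rfl
    exact (List.nodup_append.1 hl).2.2 r hr r (by simp) rfl
  have h2 : ∀ r ∈ l2, r ≠ q := by
    rintro r hr rfl
    exact (List.nodup_cons.1 (List.nodup_append.1 hl).2.1).1 hr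
  rw [List.map_append, List.map_cons, List.map_append, List.map_cons,
    List.map_congr_left (g := f) fun r hr => if_neg (h1 r hr),
    List.map_congr_left (g := f) fun r hr => if_neg (h2 r hr)]
  simp only [if_true, List.sum_append, List.sum_cons]
  ring

open Classical in
/-- Omitting at most one term, not the last one, makes a sum odd. -/
theorem exists_option_sum_eq_one {f : V → ZMod 2} {l : List V} (hl : l.Nodup)
    (hf : ∃ q ∈ l, f q ≠ 0) : ∃ o : Option V,
      (∀ q ∈ o, q ∈ l ∧ f q ≠ 0 ∧ q ∉ l.getLast?) ∧
      (l.map fun r => if r ∈ o then 0 else f r).sum = 1 := by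
  have hone : ∀ x : ZMod 2, x ≠ 0 → x = 1 := by decide
  by_cases hS : (l.map f).sum = 0
  -- An even sum with a nonzero term has at least two of them, so one is not at the last position
  -- and may be omitted.
  · obtain ⟨q, hq, hq0, hlast⟩ : ∃ q ∈ l, f q ≠ 0 ∧ q ∉ l.getLast? := by
      by_contra! hcon
      rcases List.eq_nil_or_concat l with rfl | ⟨l, z, rfl⟩
      · simp at hf
      · rw [List.concat_eq_append] at *
        have h0 : ∀ q ∈ l, f q = 0 := by
          intro q hq
          by_contra hq0
          have := hcon q (by simp [hq]) hq0
          rw [List.getLast?_concat, Option.mem_some_iff] at this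
          subst this
          exact (List.nodup_append.1 hl).2.2 z hq z (by simp) rfl
        obtain ⟨q, hq, hq0⟩ := hf
        have hz : f z ≠ 0 := by
          rcases List.mem_append.1 hq with hq | hq
          · exact absurd (h0 q hq) hq0
          · rwa [← List.mem_singleton.1 hq]
        rw [List.map_append, List.map_congr_left (g := fun _ => (0 : ZMod 2)) h0] at hS
        simp [hz] at hS
    refine ⟨some q, ?_, ?_⟩
    · rintro _ ⟨⟩
      exact ⟨hq, hq0, hlast⟩
    have := sum_map_ite_add (f := f) hl hq
    rw [hS, hone _ hq0] at this
    have hmap : (l.map fun r => if r ∈ some q then 0 else f r) =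
        l.map fun r => if r = q then 0 else f r := List.map_congr_left fun r _ => by
      by_cases h : r = q
      · simp [h]
      · simp [h, Ne.symm h]
    rw [hmap]
    exact (by decide : ∀ x : ZMod 2, x + 1 = 0 → x = 1) _ this
  · exact ⟨none, by simp, by simpa using hone _ hS⟩

/-- An induced path with many vertices attached to it at vertices that are pairwise distinct and
non-adjacent can be contracted to a star. -/
theorem exists_star_of_path (n : ℕ) : ∃ N : ℕ, ∀ {ι : Type u} {V : Type v} (G : SimpleGraph V)
    (p : V) (l : List V) (m : ι → V) (I : Finset ι), N ≤ I.card → IsIndPath G (p :: l) →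
    (∀ i ∈ I, m i ∉ p :: l) → (∀ i ∈ I, ∃ r ∈ p :: l, G.Adj r (m i)) →
    (∀ i ∈ I, ∀ j ∈ I, i ≠ j → m i ≠ m j ∧ ∀ r ∈ p :: l, ∀ r' ∈ p :: l,
      G.Adj r (m i) → G.Adj r' (m j) → r ≠ r' ∧ ¬ G.Adj r r') →
    ∃ σ : List V, (∀ x ∈ σ, x ∈ p :: l) ∧ ∃ I' ⊆ I, n ≤ I'.card ∧
      (∀ i ∈ I', (localComplements G σ).Adj p (m i)) ∧
      ∀ i ∈ I', ∀ j ∈ I', i ≠ j → ¬ (localComplements G σ).Adj (m i) (m j) := by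
  classical
  obtain ⟨N, hN⟩ := exists_clique_or_independent.{u} n n
  -- The extra one pays for the at most one attached vertex that is already adjacent to `p`.
  refine ⟨N + 1, fun {ι V} G p l m I hI hl hm hit hfar => ?_⟩
  let I₀ := I.filter fun i => ¬ G.Adj p (m i)
  have hI₀ : ∀ i ∈ I₀, i ∈ I ∧ ¬ G.Adj p (m i) := fun i hi => Finset.mem_filter.1 hi
  have hcard : N ≤ I₀.card := by
    have h1 := Finset.card_filter_add_card_filter_not (s := I) fun i => G.Adj p (m i)
    have h2 : (I.filter fun i => G.Adj p (m i)).card ≤ 1 := by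
      refine Finset.card_le_one.2 fun i hi j hj => ?_
      rw [Finset.mem_filter] at hi hj
      by_contra hij
      exact ((hfar i hi.1 j hj.1 hij).2 p (by simp) p (by simp) hi.2 hj.2).1 rfl
    have h3 : I₀.card = (I.filter fun i => ¬ G.Adj p (m i)).card := rfl
    omega
  have hopt : ∀ i ∈ I₀, ∃ o : Option V,
      (∀ q ∈ o, q ∈ l ∧ G.Adj q (m i) ∧ q ∉ l.getLast?) ∧
      (l.map fun r => if r ∈ o then 0 else ind G r (m i)).sum = 1 := by
    intro i hi
    obtain ⟨r, hr, hri⟩ := hit i (hI₀ i hi).1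
    have hrl : r ∈ l := (List.mem_cons.1 hr).resolve_left fun e => (hI₀ i hi).2 (e ▸ hri)
    obtain ⟨o, h1, h2⟩ := exists_option_sum_eq_one (f := fun r => ind G r (m i)) hl.2.2.2.nodup
      ⟨r, hrl, by simp [ind_eq_one.2 hri]⟩
    refine ⟨o, fun q hq => ⟨(h1 q hq).1, ?_, (h1 q hq).2.2⟩, h2⟩
    by_contra hcon
    exact (h1 q hq).2.1 (ind_eq_zero.2 hcon)
  choose! o ho hsum using hopt
  -- All skipped vertices are treated at once. Those chosen for different indices are non-adjacent
  -- and each index has at most one, so no two consecutive vertices are skipped; nor is the last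
  -- vertex.
  obtain ⟨σ, hσ, hσsum⟩ := exists_localComplements_sum (fun q => ∃ i ∈ I₀, q ∈ o i) l p hl (by
    rintro q l' ⟨l'', hsuf⟩ ⟨i, hi, hqi⟩
    cases l' with
    | nil =>
      refine absurd ?_ (ho i hi q hqi).2.2
      simp [← hsuf]
    | cons r l' =>
      refine ⟨r, by simp, ?_⟩
      rintro ⟨j, hj, hrj⟩
      have hpath : IsIndPath G (q :: r :: l') := by
        have := hl.2.2.2
        rw [← hsuf] at this
        exact this.of_append_right
      by_cases hij : i = j
      · subst hij
        have : q = r := Option.mem_unique hqi hrj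
        exact hpath.1 (by simp [this])
      · exact ((hfar i (hI₀ i hi).1 j (hI₀ j hj).1 hij).2 q (by simp [(ho i hi q hqi).1]) r
          (by simp [(ho j hj r hrj).1]) (ho i hi q hqi).2.1 (ho j hj r hrj).2.1).2
          (hpath.2.1 r (by simp)))
  have hadj : ∀ i ∈ I₀, (localComplements G σ).Adj p (m i) := by
    intro i hi
    rw [← ind_eq_one, hσsum (m i) (hm i (hI₀ i hi).1), ind_eq_zero.2 (hI₀ i hi).2, zero_add,
      ← hsum i hi]
    congr 1
    refine List.map_congr_left fun r hr => ?_
    by_cases hri : r ∈ o i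
    · rw [if_pos ⟨i, hi, hri⟩, if_pos hri]
    · rw [if_neg hri]
      split_ifs with hsk
      · obtain ⟨j, hj, hrj⟩ := hsk
        -- A vertex skipped for another index `j` is not adjacent to `m i`, so skipping it does not
        -- affect the parity at `m i`.
        have hij : i ≠ j := by rintro rfl; exact hri hrj
        refine (ind_eq_zero.2 fun e => ?_).symm
        exact ((hfar i (hI₀ i hi).1 j (hI₀ j hj).1 hij).2 r (by simp [hr]) r (by simp [hr]) e
          (ho j hj r hrj).2.1).1 rfl
      · rfl
  rcases hN (fun i j => (localComplements G σ).Adj (m i) (m j)) (fun i j h => h.symm) I₀ hcard with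
    ⟨t, ht, htn, hclique⟩ | ⟨t, ht, htn, hind⟩
  -- If the attached vertices form a clique, one more complementation at their common neighbour `p`
  -- makes them independent.
  · refine ⟨σ ++ [p], ?_, t, fun i hi => (hI₀ i (ht hi)).1, htn, fun i hi => ?_,
      fun i hi j hj hij => ?_⟩
    · intro x hx
      simp only [List.mem_append, List.mem_cons, List.not_mem_nil, or_false] at hx ⊢
      exact hx.elim (fun hx => Or.inr (hσ x hx)) Or.inl
    · rw [localComplements_append]
      exact (localComplement_adj_of_not_adj (SimpleGraph.irrefl _)).2 (hadj i (ht hi))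
    · rw [localComplements_append, ← ind_eq_zero]
      simp only [localComplements]
      rw [ind_localComplement (hfar i (hI₀ i (ht hi)).1 j (hI₀ j (ht hj)).1 hij).1,
        ind_eq_one.2 (hclique i hi j hj hij), ind_eq_one.2 (hadj i (ht hi)),
        ind_eq_one.2 (hadj j (ht hj))]
      rfl
  · exact ⟨σ, fun x hx => by simp [hσ x hx], t, fun i hi => (hI₀ i (ht hi)).1, htn,
      fun i hi => hadj i (ht hi), hind⟩

end Contraction

/-! ### Simultaneous Ramsey for several relations -/

section Homogeneous

/-- Ramsey's theorem is applied once per relation; homogeneity passes to subsets, so earlier choices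
are not spoilt. -/
theorem exists_homogeneous {κ : Type w} (s : Finset κ) (n : ℕ) : ∃ N : ℕ, ∀ {ι : Type u}
    (r : κ → ι → ι → Prop), (∀ w i j, r w i j → r w j i) → ∀ I : Finset ι, N ≤ I.card →
      ∃ I' ⊆ I, n ≤ I'.card ∧ ∀ w ∈ s, (∀ i ∈ I', ∀ j ∈ I', i ≠ j → r w i j) ∨
        (∀ i ∈ I', ∀ j ∈ I', i ≠ j → ¬ r w i j) := by
  classical
  induction s using Finset.induction_on generalizing n with
  | empty => exact ⟨n, fun r _ I hI => ⟨I, subset_rfl, hI, by simp⟩⟩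
  | @insert w s hw ih =>
    obtain ⟨N₁, h₁⟩ := exists_clique_or_independent.{u} n n
    obtain ⟨N, hN⟩ := ih N₁
    refine ⟨N, fun {ι} r hr I hI => ?_⟩
    obtain ⟨J, hJI, hJ, hJs⟩ := hN r hr I hI
    have hs : ∀ t ⊆ J, ∀ w ∈ s, (∀ i ∈ t, ∀ j ∈ t, i ≠ j → r w i j) ∨
        (∀ i ∈ t, ∀ j ∈ t, i ≠ j → ¬ r w i j) := fun t ht w hw =>
      (hJs w hw).imp (fun h i hi j hj => h i (ht hi) j (ht hj))
        fun h i hi j hj => h i (ht hi) j (ht hj)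
    rcases h₁ (r w) (hr w) J hJ with ⟨t, ht, htn, h⟩ | ⟨t, ht, htn, h⟩
    · exact ⟨t, ht.trans hJI, htn, Finset.forall_mem_insert _ _ _ |>.2 ⟨Or.inl h, hs t ht⟩⟩
    · exact ⟨t, ht.trans hJI, htn, Finset.forall_mem_insert _ _ _ |>.2 ⟨Or.inr h, hs t ht⟩⟩

end Homogeneous

/-! ### Contracting several paths simultaneously -/

section Stars

variable {X : Type*} {H : SimpleGraph X}

/-- Several paths with attached vertices can be contracted to stars simultaneously. -/
theorem exists_stars {W : Type w} (s : Finset W) (n : ℕ) : ∃ N : ℕ, ∀ {ι : Type u} {V : Type v}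
    (G : SimpleGraph V) (U : Set V) (C : W → Set V) (p : W → V) (l : W → List V)
    (m : ι → W → V) (I : Finset ι), N ≤ I.card → (∀ w, IsIndPath G (p w :: l w)) →
    (∀ w, ∀ x ∈ p w :: l w, x ∈ U) → (∀ i ∈ I, ∀ w, m i w ∈ U) →
    (∀ w, ∀ x ∈ p w :: l w, x ∈ C w) → (∀ i ∈ I, ∀ w, m i w ∈ C w) →
    (∀ w, ∀ r ∈ p w :: l w, ∀ x ∈ U, G.Adj r x → x ∈ C w) →
    (∀ w w', w ≠ w' → ∀ x ∈ C w, x ∉ C w') →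
    (∀ w, ∀ i ∈ I, m i w ∉ p w :: l w) → (∀ w, ∀ i ∈ I, ∃ r ∈ p w :: l w, G.Adj r (m i w)) →
    (∀ w, ∀ i ∈ I, ∀ j ∈ I, i ≠ j → m i w ≠ m j w ∧ ∀ r ∈ p w :: l w, ∀ r' ∈ p w :: l w,
      G.Adj r (m i w) → G.Adj r' (m j w) → r ≠ r' ∧ ¬ G.Adj r r') →
    ∃ G' : SimpleGraph V, ∃ I' ⊆ I, n ≤ I'.card ∧
      (HasVertexMinor H (G'.induce U) → HasVertexMinor H (G.induce U)) ∧
      (∀ x ∈ U, ∀ y ∈ U, (∀ w ∈ s, ¬ (x ∈ C w ∧ y ∈ C w)) → (G'.Adj x y ↔ G.Adj x y)) ∧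
      (∀ w ∈ s, ∀ i ∈ I', G'.Adj (p w) (m i w)) ∧
      ∀ w ∈ s, ∀ i ∈ I', ∀ j ∈ I', i ≠ j → ¬ G'.Adj (m i w) (m j w) := by
  classical
  induction s using Finset.induction_on generalizing n with
  | empty =>
    exact ⟨n, fun G U C p l m I hI _ _ _ _ _ _ _ _ _ _ =>
      ⟨G, I, subset_rfl, hI, id, by simp, by simp, by simp⟩⟩
  | @insert w s hw ih =>
    obtain ⟨N₁, h₁⟩ := exists_star_of_path.{u, v} n
    obtain ⟨N, hN⟩ := ih N₁
    refine ⟨N, fun {ι V} G U C p l m I hI hl hlU hmU hlC hmC hnb hC hml hit hfar => ?_⟩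
    obtain ⟨G₁, I₁, hI₁, hcard, hvm, hagree, hstar, hindep⟩ :=
      hN G U C p l m I hI hl hlU hmU hlC hmC hnb hC hml hit hfar
    have hws : ∀ w' ∈ s, w ≠ w' := fun w' hw' e => hw (e ▸ hw')
    -- Earlier contractions toggle only pairs inside other columns, which are disjoint from `C w`,
    -- so the path of `w` and its attachments are still as in `G`.
    have hrow : ∀ x ∈ U, x ∈ C w → ∀ y ∈ U, G₁.Adj x y ↔ G.Adj x y := fun x hx hxC y hy =>
      hagree x hx y hy fun w' hw' h => hC w w' (hws w' hw') x hxC h.1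
    have hrow' : ∀ r ∈ p w :: l w, ∀ y ∈ U, G₁.Adj r y ↔ G.Adj r y := fun r hr =>
      hrow r (hlU w r hr) (hlC w r hr)
    obtain ⟨σ, hσ, I₂, hI₂, hcard₂, hstar₂, hindep₂⟩ := h₁ G₁ (p w) (l w) (fun i => m i w) I₁ hcard
      ((hl w).congr fun x hx y hy => (hrow' x hx y (hlU w y hy)).symm)
      (fun i hi => hml w i (hI₁ hi))
      (fun i hi => by
        obtain ⟨r, hr, hri⟩ := hit w i (hI₁ hi)
        exact ⟨r, hr, (hrow' r hr _ (hmU i (hI₁ hi) w)).2 hri⟩)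
      (fun i hi j hj hij => by
        refine ⟨(hfar w i (hI₁ hi) j (hI₁ hj) hij).1, fun r hr r' hr' h h' => ?_⟩
        rw [hrow' r hr _ (hlU w r' hr')]
        exact (hfar w i (hI₁ hi) j (hI₁ hj) hij).2 r hr r' hr'
          ((hrow' r hr _ (hmU i (hI₁ hi) w)).1 h) ((hrow' r' hr' _ (hmU j (hI₁ hj) w)).1 h'))
    have hloc : ∀ x ∈ U, ∀ y ∈ U, ¬ (x ∈ C w ∧ y ∈ C w) →
        ((localComplements G₁ σ).Adj x y ↔ G₁.Adj x y) := fun x hx y hy hxy =>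
      localComplements_adj_of_local (P := {x | x ∈ p w :: l w}) (C := C w) (hlU w)
        (fun r hr y hy h => hnb w r hr y hy ((hrow' r hr y hy).1 h)) hσ hx hy hxy
    refine ⟨localComplements G₁ σ, I₂, hI₂.trans hI₁, hcard₂,
      fun h => hvm (h.of_induce_localComplements fun x hx => hlU w x (hσ x hx)), ?_, ?_, ?_⟩
    · intro x hx y hy hxy
      rw [hloc x hx y hy (hxy w (by simp)), hagree x hx y hy fun w' hw' => hxy w' (by simp [hw'])]
    · intro w' hw' i hi
      rcases Finset.mem_insert.1 hw' with rfl | hw'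
      · exact hstar₂ i hi
      · rw [hloc _ (hlU w' _ (by simp)) _ (hmU i (hI₁ (hI₂ hi)) w') fun h =>
          hC w w' (hws w' hw') _ h.1 (hlC w' _ (by simp))]
        exact hstar w' hw' i (hI₂ hi)
    · intro w' hw' i hi j hj hij
      rcases Finset.mem_insert.1 hw' with rfl | hw'
      · exact hindep₂ i hi j hj hij
      · rw [hloc _ (hmU i (hI₁ (hI₂ hi)) w') _ (hmU j (hI₁ (hI₂ hj)) w') fun h =>
          hC w w' (hws w' hw') _ h.1 (hmC i (hI₁ (hI₂ hi)) w')]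
        exact hindep w' hw' i (hI₂ hi) j (hI₂ hj) hij

end Stars

/-! ### The two configurations in a long cover -/

section Cover

variable {V : Type v} {G : SimpleGraph V} {q h : ℕ} {L : Fin q → Fin 4 → Set V} {C : Set V}

theorem IsLongMultiCover.eq_of_mem (hL : IsLongMultiCover G L C) {i j : Fin q} {a b : Fin 4}
    {x : V} (hi : x ∈ L i a) (hj : x ∈ L j b) : i = j := by
  by_contra hij
  exact Set.disjoint_left.1 (hL.disjoint hij) (Set.mem_iUnion.2 ⟨a, hi⟩) (Set.mem_iUnion.2 ⟨b, hj⟩)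

theorem IsLongMultiCover.not_adj (hL : IsLongMultiCover G L C) {i j : Fin q} (hij : i < j)
    {a b : Fin 4} {x y : V} (hx : x ∈ L i a) (hy : y ∈ L j b) (hb : b ≠ 3) : ¬ G.Adj x y := by
  intro hxy
  refine hL.anti i j hij y ?_ x ?_ hxy.symm
  · fin_cases b <;> simp_all
  · fin_cases a <;> simp_all

/-- Every vertex of the last set of a long cover is reached from the first set. -/
theorem IsLongCover.exists_leg {L : Fin 4 → Set V} (hL : IsLongCover G L C) {x : V}
    (hx : x ∈ L 3) : ∃ n o t, n ∈ L 2 ∧ o ∈ L 1 ∧ t ∈ L 0 ∧ G.Adj x n ∧ G.Adj n o ∧ G.Adj o t := by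
  obtain ⟨n, hn, h1⟩ := hL.covers 2 x hx
  obtain ⟨o, ho, h2⟩ := hL.covers 1 n hn
  obtain ⟨t, ht, h3⟩ := hL.covers 0 o ho
  exact ⟨n, o, t, hn, ho, ht, h1.symm, h2.symm, h3.symm⟩

/-- A connected set together with the vertices of legs attached to it. -/
def legRow {W : Type w} (L₀ : Set V) (n o m : W → V) : Set V :=
  {x | x ∈ L₀ ∨ ∃ w, x = n w ∨ x = o w ∨ x = m w}

theorem legRow_preconnected {W : Type w} {L₀ : Set V} {n o t m : W → V}
    (hL : (G.induce L₀).Preconnected)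
    (ht : ∀ w, t w ∈ L₀) (hmn : ∀ w, G.Adj (m w) (n w)) (hno : ∀ w, G.Adj (n w) (o w))
    (hot : ∀ w, G.Adj (o w) (t w)) : (G.induce (legRow L₀ n o m)).Preconnected := by
  have hsub : L₀ ⊆ legRow L₀ n o m := fun x hx => Or.inl hx
  have h0 : ∀ x y : L₀, (G.induce (legRow L₀ n o m)).Reachable ⟨x, hsub x.2⟩ ⟨y, hsub y.2⟩ :=
    fun x y => (hL x y).map (G.induceHomOfLE hsub).toHom
  have step : ∀ {x y : V} (hx : x ∈ legRow L₀ n o m) (hy : y ∈ legRow L₀ n o m), G.Adj x y →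
      (G.induce (legRow L₀ n o m)).Reachable ⟨x, hx⟩ ⟨y, hy⟩ := fun hx hy hxy =>
    SimpleGraph.Adj.reachable (G := G.induce (legRow L₀ n o m)) hxy
  have key : ∀ x : legRow L₀ n o m, ∃ y : L₀,
      (G.induce (legRow L₀ n o m)).Reachable x ⟨y, hsub y.2⟩ := by
    rintro ⟨x, hx⟩
    rcases id hx with hx' | ⟨w, hx'⟩
    · exact ⟨⟨x, hx'⟩, .refl _⟩
    · have ho : o w ∈ legRow L₀ n o m := Or.inr ⟨w, by simp⟩
      have hn : n w ∈ legRow L₀ n o m := Or.inr ⟨w, by simp⟩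
      have h1 := step ho (hsub (ht w)) (hot w)
      have h2 := (step hn ho (hno w)).trans h1
      refine ⟨⟨t w, ht w⟩, ?_⟩
      rcases hx' with rfl | rfl | rfl
      · exact h2
      · exact h1
      · exact (step hx hn (hmn w)).trans h2
  intro x y
  obtain ⟨x', hx⟩ := key x
  obtain ⟨y', hy⟩ := key y
  exact (hx.trans (h0 x' y')).trans hy.symm

variable [Finite V] {W : Type w} [Finite W] {H : SimpleGraph W}
  {m : Fin q → Fin h → V}

/-- The ends at the largest index of `I` are all attached to each earlier `L i 0`. A common
neighbour of two of them would put them at distance at most two, so attachments are private. One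
index is spent on the ends, whence the `+ 1`. -/
theorem hasVertexMinor_of_attached (hL : IsLongMultiCover G L C)
    (hfar : ∀ s t : Fin q × Fin h, s ≠ t → ∀ p : G.Walk (m s.1 s.2) (m t.1 t.2), 6 ≤ p.length)
    (hm : ∀ i j, m i j ∈ L i 3) {I : Finset (Fin q)}
    (hI : Nat.card (W → W → ZMod 2) + 1 ≤ I.card) (col : W ↪ Fin h)
    (hadj : ∀ w, ∀ i ∈ I, ∀ j ∈ I, i < j → ∃ x ∈ L i 0, G.Adj (m j (col w)) x) :
    HasVertexMinor H G := by
  classical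
  have hne : I.Nonempty := Finset.card_pos.1 (by omega)
  set t := I.max' hne
  have htI : t ∈ I := I.max'_mem hne
  have hlt : ∀ i ∈ I.erase t, i ∈ I ∧ i < t := fun i hi =>
    ⟨Finset.mem_of_mem_erase hi, lt_of_le_of_ne (I.le_max' i (Finset.mem_of_mem_erase hi))
      (Finset.ne_of_mem_erase hi)⟩
  refine .of_induce (hasVertexMinor_of_rows (U := Set.univ) (Z := fun w => m t (col w))
    (R := fun i => L i 0) (s := I.erase t) ?_ (by simp) ?_ (by simp) ?_ ?_ ?_ ?_)
  · intro a b hab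
    by_contra hne
    have := hfar (t, col a) (t, col b) (by simpa using hne)
      ((SimpleGraph.Walk.nil : G.Walk (m t (col a)) (m t (col a))).copy rfl hab)
    simp at this
  · rw [Finset.card_erase_of_mem htI]; omega
  · intro i hi a ha
    exact (hlt i hi).2.ne (hL.eq_of_mem ha (hm t (col a)))
  · intro i hi j hj hij x hx y hy hxy
    rcases lt_or_gt_of_ne hij with h | h
    · exact hL.not_adj h hx hy (by decide) hxy
    · exact hL.not_adj h hy hx (by decide) hxy.symm
  · exact fun i _ => (hL.longCover i).connected.preconnected
  · intro i hi a
    obtain ⟨x, hx, hxa⟩ := hadj a i (hlt i hi).1 t htI (hlt i hi).2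
    refine ⟨x, hx, fun c => ⟨fun hxc => ?_, fun e => e ▸ hxa.symm⟩⟩
    by_contra hca
    have := hfar (t, col a) (t, col c) (by simpa using fun e => hca e.symm)
      (.cons hxa (.cons hxc .nil))
    simp at this

/-- Here the ends at later indices do not see earlier sets `L i 0`, so rows may be extended by legs
down to their ends and remain anti-complete. Contracting each path to a star then turns its ends
into private attachments of the star's centre. -/
theorem exists_of_unattached (H : SimpleGraph W) : ∃ N : ℕ, ∀ {V : Type v} [Finite V]
    {G : SimpleGraph V} {q h : ℕ} {L : Fin q → Fin 4 → Set V} {C : Set V} {P : Fin h → Set V}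
    {m : Fin q → Fin h → V}, IsLongMultiCover G L C → PathsDangleSpaciously G L P →
    (∀ s t : Fin q × Fin h, s ≠ t → ∀ p : G.Walk (m s.1 s.2) (m t.1 t.2), 6 ≤ p.length) →
    (∀ i j, m i j ∈ L i 3) →
    (∀ j, neighbourhood (G.induce (coverAndPaths L P)) (Subtype.val ⁻¹' P j) =
      Subtype.val ⁻¹' Set.range fun i => m i j) →
    ∀ I : Finset (Fin q), N ≤ I.card → ∀ col : W ↪ Fin h,
    (∀ w, ∀ i ∈ I, ∀ j ∈ I, i < j → ∀ x ∈ L i 0, ¬ G.Adj (m j (col w)) x) →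
    HasVertexMinor H G := by
  classical
  have := Fintype.ofFinite W
  obtain ⟨N, hN⟩ := exists_stars.{0, v, w} (H := H) (Finset.univ : Finset W)
    (Nat.card (W → W → ZMod 2))
  refine ⟨N, fun {V} _ {G q h L C P m} hL hP hfar hm hnbr I hI col hadj => ?_⟩
  have hleg := fun i w => (hL.longCover i).exists_leg (hm i (col w))
  choose n o t hn ho ht hmn hno hot using hleg
  choose p l hpath hmemP using fun w => (hP.isInducedPath (col w)).exists_list
  -- `R i` is the row of index `i`, `D w` the column of a path with its ends in the rows of `I`, and
  -- `U` the part of the graph that is kept.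
  let R : Fin q → Set V := fun i => legRow (L i 0) (n i) (o i) fun w => m i (col w)
  let D : W → Set V := fun w => {x | x ∈ P (col w) ∨ ∃ i ∈ I, x = m i (col w)}
  let U : Set V := {x | (∃ w, x ∈ P (col w)) ∨ ∃ i ∈ I, x ∈ R i}
  have hRL : ∀ i, ∀ x ∈ R i, ∃ a, x ∈ L i a := by
    rintro i x (hx | ⟨w, rfl | rfl | rfl⟩)
    exacts [⟨0, hx⟩, ⟨2, hn i w⟩, ⟨1, ho i w⟩, ⟨3, hm i _⟩]
  have hmR : ∀ i w, m i (col w) ∈ R i := fun i w => Or.inr ⟨w, by simp⟩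
  have hPL : ∀ j x, x ∈ P j → ∀ i a, x ∉ L i a := fun j x hx i a =>
    Set.disjoint_left.1 (hP.disjoint_cover j i a) hx
  have hcol : ∀ {w w'}, w ≠ w' → col w ≠ col w' := fun h => col.injective.ne h
  have hminj : ∀ {i j w w'}, m i (col w) = m j (col w') → i = j ∧ w = w' := by
    intro i j w w' e
    by_contra hne
    have := hfar (i, col w) (j, col w') (by simpa using hne)
      ((SimpleGraph.Walk.nil : G.Walk (m i (col w)) (m i (col w))).copy rfl e)
    simp at this
  have hnb : ∀ w, ∀ r ∈ P (col w), ∀ x ∈ U, G.Adj r x → x ∈ D w := by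
    intro w r hr x hx hrx
    by_cases hxP : x ∈ P (col w)
    · exact Or.inl hxP
    · have hxU : x ∈ coverAndPaths L P := by
        rcases hx with ⟨w', hw'⟩ | ⟨i, -, hi⟩
        · exact Or.inr (Set.mem_iUnion.2 ⟨_, hw'⟩)
        · obtain ⟨a, ha⟩ := hRL i x hi
          exact Or.inl (Set.mem_iUnion.2 ⟨i, Set.mem_iUnion.2 ⟨a, ha⟩⟩)
      have hrU : r ∈ coverAndPaths L P := Or.inr (Set.mem_iUnion.2 ⟨_, hr⟩)
      have : (⟨x, hxU⟩ : coverAndPaths L P) ∈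
          neighbourhood (G.induce (coverAndPaths L P)) (Subtype.val ⁻¹' P (col w)) :=
        ⟨hxP, ⟨r, hrU⟩, hr, hrx⟩
      rw [hnbr] at this
      obtain ⟨i, hi⟩ := this
      have hi : m i (col w) = x := hi
      refine Or.inr ⟨i, ?_, hi.symm⟩
      rcases hx with ⟨w', hw'⟩ | ⟨j, hj, hxj⟩
      · exact absurd (hi ▸ hm i (col w)) (hPL _ _ hw' i 3)
      · obtain ⟨a, ha⟩ := hRL j x hxj
        rwa [hL.eq_of_mem (hi ▸ hm i (col w) : x ∈ L i 3) ha]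
  have hD : ∀ w w', w ≠ w' → ∀ x ∈ D w, x ∉ D w' := by
    rintro w w' hne x (hx | ⟨i, -, rfl⟩) (hx' | ⟨j, -, hj⟩)
    · exact Set.disjoint_left.1 (hP.disjoint (hcol hne)) hx hx'
    · exact hPL _ _ hx j 3 (hj ▸ hm j _)
    · exact hPL _ _ hx' i 3 (hm i _)
    · exact hne (hminj hj).2
  have hit : ∀ w i, ∃ r ∈ P (col w), G.Adj r (m i (col w)) := by
    intro w i
    have hmU : m i (col w) ∈ coverAndPaths L P :=
      Or.inl (Set.mem_iUnion.2 ⟨i, Set.mem_iUnion.2 ⟨3, hm i _⟩⟩)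
    have : (⟨m i (col w), hmU⟩ : coverAndPaths L P) ∈
        neighbourhood (G.induce (coverAndPaths L P)) (Subtype.val ⁻¹' P (col w)) := by
      rw [hnbr]; exact ⟨i, rfl⟩
    obtain ⟨-, r, hr, hadj⟩ := this
    exact ⟨r.1, hr, hadj⟩
  -- The cover itself excludes all edges except those into an end of the later row. Such an edge
  -- from `L i 0` is excluded by `hadj`; from a leg it would join two ends by a walk of length at
  -- most three.
  have hanti : ∀ i ∈ I, ∀ j ∈ I, i < j → ∀ x ∈ R i, ∀ y ∈ R j, ¬ G.Adj x y := by
    intro i hi j hj hij x hx y hy hxy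
    obtain ⟨a, ha⟩ := hRL i x hx
    rcases hy with hy | ⟨w, rfl | rfl | rfl⟩
    · exact hL.not_adj hij ha hy (by decide) hxy
    · exact hL.not_adj hij ha (hn j w) (by decide) hxy
    · exact hL.not_adj hij ha (ho j w) (by decide) hxy
    · have hwalk : ∀ w', ∀ c : G.Walk (m i (col w')) (m j (col w)), 6 ≤ c.length := fun w' =>
        hfar (i, col w') (j, col w) (by simp [hij.ne])
      rcases hx with hx | ⟨w', rfl | rfl | rfl⟩
      · exact hadj w i hi j hj hij x hx hxy.symm
      · have := hwalk w' (.cons (hmn i w') (.cons hxy .nil))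
        simp at this
      · have := hwalk w' (.cons (hmn i w') (.cons (hno i w') (.cons hxy .nil)))
        simp at this
      · have := hwalk w' (.cons hxy .nil)
        simp at this
  -- A row meets a column only in the corresponding end, so the contractions toggle no pair inside a
  -- row, and between two rows only pairs of ends of one column.
  have hRD : ∀ i, ∀ x ∈ R i, ∀ w, x ∈ D w → x = m i (col w) := by
    rintro i x hx w (hxP | ⟨j, -, rfl⟩)
    · obtain ⟨a, ha⟩ := hRL i x hx
      exact absurd ha (hPL _ _ hxP i a)
    · obtain ⟨a, ha⟩ := hRL i _ hx
      rw [hL.eq_of_mem ha (hm j _)]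
  obtain ⟨G', I', hI', hcard, hvm, hagree, hstar, hindep⟩ :=
    hN G U D p l (fun i w => m i (col w)) I hI hpath
      (fun w x hx => Or.inl ⟨w, (hmemP w x).1 hx⟩) (fun i hi w => Or.inr ⟨i, hi, hmR i w⟩)
      (fun w x hx => Or.inl ((hmemP w x).1 hx)) (fun i hi w => Or.inr ⟨i, hi, rfl⟩)
      (fun w r hr => hnb w r ((hmemP w r).1 hr)) hD
      (fun w i _ hx => hPL _ _ ((hmemP w _).1 hx) i 3 (hm i _))
      (fun w i _ => by
        obtain ⟨r, hr, hri⟩ := hit w i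
        exact ⟨r, (hmemP w r).2 hr, hri⟩)
      (fun w i _ j _ hij => by
        have hwalk := hfar (i, col w) (j, col w) (by simp [hij])
        refine ⟨fun e => hij (hminj e).1, fun r _ r' _ h h' => ⟨?_, fun hrr => ?_⟩⟩
        · rintro rfl
          have := hwalk (.cons h.symm (.cons h' .nil))
          simp at this
        · have := hwalk (.cons h.symm (.cons hrr (.cons h' .nil)))
          simp at this)
  have hp : ∀ w, p w ∈ P (col w) := fun w => (hmemP w _).1 (by simp)
  have hRU : ∀ i ∈ I', R i ⊆ U := fun i hi x hx => Or.inr ⟨i, hI' hi, hx⟩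
  refine .of_induce (hvm (hasVertexMinor_of_rows (Z := p) (R := R) (s := I') ?_
    (fun w => Or.inl ⟨w, hp w⟩) hcard hRU ?_ ?_ ?_ ?_))
  · intro a b hab
    by_contra hne
    exact Set.disjoint_left.1 (hP.disjoint (hcol hne)) (hp a) (hab ▸ hp b)
  · intro i _ a ha
    obtain ⟨b, hb⟩ := hRL i _ ha
    exact hPL _ _ (hp a) i b hb
  · intro i hi j hj hij x hx y hy
    by_cases hxy : ∃ w, x ∈ D w ∧ y ∈ D w
    · obtain ⟨w, hxw, hyw⟩ := hxy
      rw [hRD i x hx w hxw, hRD j y hy w hyw]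
      exact hindep w (by simp) i hi j hj hij
    · rw [hagree x (hRU i hi hx) y (hRU j hj hy) fun w _ h => hxy ⟨w, h⟩]
      rcases lt_or_gt_of_ne hij with h | h
      · exact hanti i (hI' hi) j (hI' hj) h x hx y hy
      · exact fun e => hanti j (hI' hj) i (hI' hi) h y hy x hx e.symm
  · intro i hi
    have : G'.induce (R i) = G.induce (R i) := by
      ext x y
      by_cases hxy : ∃ w, x.1 ∈ D w ∧ y.1 ∈ D w
      · obtain ⟨w, hxw, hyw⟩ := hxy
        have : x = y := Subtype.ext ((hRD i x x.2 w hxw).trans (hRD i y y.2 w hyw).symm)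
        subst this
        simp
      · exact hagree x (hRU i hi x.2) y (hRU i hi y.2) fun w _ h => hxy ⟨w, h⟩
    rw [this]
    exact legRow_preconnected (hL.longCover i).connected.preconnected (ht i) (hmn i) (hno i) (hot i)
  · intro i hi a
    -- The star supplies the adjacency to `p a`. A pair in different columns is as in `G`, where all
    -- neighbours of `p c` in `U` lie in its own column.
    refine ⟨m i (col a), hmR i a, fun c => ⟨fun hadj => ?_,
      fun e => e ▸ (hstar a (by simp) i hi).symm⟩⟩
    by_contra hca
    have hma : m i (col a) ∈ D a := Or.inr ⟨i, hI' hi, rfl⟩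
    rw [hagree _ (hRU i hi (hmR i a)) _ (Or.inl ⟨c, hp c⟩) fun w _ h => ?_] at hadj
    · exact hD a c (Ne.symm hca) _ hma (hnb c _ (hp c) _ (hRU i hi (hmR i a)) hadj.symm)
    · by_cases hwa : w = a
      · exact hD a c (Ne.symm hca) _ (hwa ▸ h.2) (Or.inl (hp c))
      · exact hD w a hwa _ h.1 hma

end Cover

end VMinor

/-! ### Choice of the constants and the dichotomy between columns -/

theorem mainTheorem8 {W : Type*} [Finite W] (H : SimpleGraph W) :
    ∃ q' h' : ℕ, 0 < q' ∧ 0 < h' ∧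
      ∀ (V : Type*) [Finite V] (G : SimpleGraph V)
        (L : Fin q' → Fin 4 → Set V) (C : Set V) (P : Fin h' → Set V),
        VMinor.IsLongMultiCover G L C →
        VMinor.PathsDangleSpaciously G L P →
        VMinor.HasVertexMinor H G := by
  classical
  have := Fintype.ofFinite W
  obtain ⟨N₁, h₁⟩ := VMinor.exists_of_unattached H
  obtain ⟨N, hN⟩ := VMinor.exists_homogeneous
    (Finset.univ : Finset (Fin (2 * Fintype.card W + 1)))
    (max N₁ (Nat.card (W → W → ZMod 2) + 1))
  -- With this many columns one of the two kinds occurs at least `Fintype.card W` times; the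
  -- additional ones only ensure positivity.
  refine ⟨N + 1, 2 * Fintype.card W + 1, by omega, by omega, fun V _ G L C P hL hP => ?_⟩
  obtain ⟨m, hdist, hm, hdangle⟩ := hP.exists_ends
  have hfar : ∀ s t : Fin (N + 1) × Fin (2 * Fintype.card W + 1), s ≠ t →
      ∀ p : G.Walk (m s.1 s.2) (m t.1 t.2), 6 ≤ p.length := fun s t hst p => by
    exact_mod_cast (hdist hst).trans (SimpleGraph.edist_le p)
  -- Attachment of the later end to the earlier `L i 0` is symmetrised so that Ramsey's theorem for
  -- graphs applies.
  obtain ⟨I, -, hI, hhom⟩ := hN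
    (fun w i j => (i < j ∧ ∃ x ∈ L i 0, G.Adj (m j w) x) ∨ (j < i ∧ ∃ x ∈ L j 0, G.Adj (m i w) x))
    (fun w i j h => h.symm) Finset.univ (by simp)
  set A : Finset (Fin (2 * Fintype.card W + 1)) := Finset.univ.filter fun w =>
    ∀ i ∈ I, ∀ j ∈ I, i < j → ∃ x ∈ L i 0, G.Adj (m j w) x
  have hA : ∀ w ∉ A, ∀ i ∈ I, ∀ j ∈ I, i < j → ∀ x ∈ L i 0, ¬ G.Adj (m j w) x := by
    intro w hw i hi j hj hij x hx hadj
    rcases hhom w (by simp) with h | h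
    · refine hw (Finset.mem_filter.2 ⟨by simp, fun i hi j hj hij => ?_⟩)
      rcases h i hi j hj hij.ne with h | h
      · exact h.2
      · exact absurd h.1 hij.not_gt
    · exact h i hi j hj hij.ne (Or.inl ⟨hij, x, hx, hadj⟩)
  have hcardA := Finset.card_add_card_compl A
  rw [Fintype.card_fin] at hcardA
  by_cases hcard : Fintype.card W ≤ A.card
  · obtain ⟨col⟩ : Nonempty (W ↪ A) := Function.Embedding.nonempty_of_card_le (by simpa using hcard)
    exact VMinor.hasVertexMinor_of_attached hL hfar hm ((le_max_right _ _).trans hI)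
      (col.trans (Function.Embedding.subtype _)) fun w => (Finset.mem_filter.1 (col w).2).2
  · obtain ⟨col⟩ : Nonempty (W ↪ (Aᶜ : Finset _)) :=
      Function.Embedding.nonempty_of_card_le (by rw [Fintype.card_coe]; omega)
    exact h₁ hL hP hfar hm (fun j => (hdangle j).1.2) I ((le_max_left _ _).trans hI)
      (col.trans (Function.Embedding.subtype _)) fun w => hA _ (Finset.mem_compl.1 (col w).2)
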